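/- **Setting.** Let $d\ge 1$, $n=2^d$, $\mathcal X=\{\pm1\}^n$, $\mathcal Y=\{\pm1\}$. A tree-structured Boolean circuit $C$ of depth $d$ is the full binary tree whose leaves are the input bits $x_1,\dots,x_n$ in this order (levels are numbered $0,\dots,d$ from the root, level $i$ has $2^i$ nodes) and whose inner nodes $(i,j)$, $0\le i<d$, carry arbitrary gates $\gamma_{i,j}:\{\pm1\}^2\to\{\pm1\}$. Let $\Gamma_{i}:\{\pm1\}^{2^i}\to\{\pm1\}^{2^{i-1}}$, $\Gamma_i(x)=(\gamma_{i-1,j}(x_{2j-1},x_{2j}))_j$, let $\Gamma_{i\dots i'}=\Gamma_i\circ\dots\circ\Gamma_{i'}$ (the identity if $i>i'$), and let $h_C=\Gamma_{1\dots d}$. The influence of node $(i,j)$ is $\mathcal I_{i,j}=\Pr_{x\sim U(\{\pm1\}^{2^i})}[\Gamma_{1\dots i}(x)\ne\Gamma_{1\dots i}(x_1,\dots,-x_j,\dots,x_{2^i})]$. For a distribution $\mathcal D$ on $\mathcal X\times\mathcal Y$ put $c_{i,j}=\mathbb E_{(x,y)\sim\mathcal D}[\Gamma_{(i+1)\dots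 d}(x)_j\,y]$. $\mathcal D$ satisfies the *local correlation assumption* (LCA) with parameter $\Delta$ if $|c_{i,j}|>\mathbb E_{\mathcal D}[y]+\Delta$ for all $1\le i\le d$ and $1\le j\le 2^i$ with $\mathcal I_{i,j}\ne0$. $\mathcal D$ is a *$\Delta$-non-degenerate product distribution* if the input bits $x_1,\dots,x_n$ are independent and $\Pr[x_j=1]\in(\Delta,1-\Delta)$ for every $j$. $\mathcal D$ is separable by $h$ if $\Pr_{(x,y)\sim\mathcal D}[y=h(x)]=1$. **Network and algorithm.** Let $\sigma(t)=\max(t,0)$ and $\phi(t)=\max(\min(t,1),-1)$. A neural gate of width $k$ is $g_{w,v}(u)=\phi\big(\sum_{l=1}^k v_l\,\sigma(\langle w_l,u\rangle)\big)$, $u\in\mathbb R^2$, and the block $B_{W^{(i)},V^{(i)}}:\mathbb R^{2^i}\to\mathbb R^{2^{i-1}}$ applies the $j$-th of $2^{i-1}$ such gates to $(x_{2j-1},x_{2j})$. $P$ is average pooling. For a sample $S$ let $L_S(f)=\frac1{|S|}\sum_{(x,y)\in S}\big(\max(1-yf(x),0)+\lambda|1+f(x)|\big)$. Layerwise gradient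 descent starts with $\mathcal N_d=\mathrm{id}$; for $i=d,\dots,1$ it performs $T$ steps $W^{(i)}_t=W^{(i)}_{t-1}-\eta\,\partial_{W}L_S\big(P(B_{W,V^{(i)}_0}\circ\mathcal N_i)\big)\big|_{W=W^{(i)}_{t-1}}$ and sets $\mathcal N_{i-1}=B_{W^{(i)}_T,V^{(i)}_0}\circ\mathcal N_i$; it returns $\mathcal N_0$. Gradients are computed by the chain rule, with derivative $0$ at the kinks of $\sigma$, $\phi$ and the loss. All weights are initialized independently of each other and of $S$: the entries of $V_0^{(i)}$ are uniform in $\{\pm1\}$ and are never updated; the weight vector $w\in\mathbb R^2$ of each hidden neuron has some law (possibly different for different neurons) with $\|w\|_{\max}\le\frac1{4\sqrt2k}$ almost surely and $\Pr[\langle w,p\rangle>0]=\frac12$ for each $p\in\{\pm1\}^2$ (for example, the uniform law on the box). **Theorem.** Let $\delta,\Delta\in(0,\frac12)$, $d\ge1$, $n=2^d$, $k\ge\log^{-1}(\frac43)\log(\frac{2nd}{\delta})$ and $0<\eta\le\frac1{16\sqrt2k}$. Let $C$ be a tree-structured circuit of depth $d$ such that $h_C$ is not constant, let $\mathcal D$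 be a $\Delta$-non-degenerate product distribution separable by $h_C$ with $\mathbb E_{\mathcal D}[y]\ge0$ that satisfies LCA with parameter $\Delta$, and let $\lambda=\mathbb E_{\mathcal D}[y]+\frac\Delta4$. Let $S$ consist of independent draws from $\mathcal D$ with $|S|>\frac{2^{15}}{\Delta^6}\log(\frac{8nd}{\delta})$, and let $T>\frac{24n}{\sqrt2\,\eta\,\Delta^3}$. Then, with probability at least $1-\delta$ over $S$ and the initialization, layerwise gradient descent with $T$ steps per layer returns a function $\mathcal N_0$ with $\Pr_{(x,y)\sim\mathcal D}[\mathcal N_0(x)\ne y]=0$. -/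

import Mathlib

open MeasureTheory ProbabilityTheory

/-! ## Signs and binary trees

The two-point set `{±1}` is `Bool`, with `true` for `+1` and `false` for `-1`. Levels of the tree of
depth `d` are numbered `0, …, d` from the root; level `i` has `2 ^ i` nodes, indexed from `0`. -/

/-- The real value `±1` of a sign. -/
def sgn (b : Bool) : ℝ := if b then 1 else -1

/-- The two children (on level `i + 1`) of the `j`-th node of level `i`. -/
def child {i : ℕ} (j : Fin (2 ^ i)) (c : Fin 2) : Fin (2 ^ (i + 1)) :=
  ⟨2 * j.1 + c.1, by have := j.2; have := c.2; rw [pow_succ]; omega⟩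

/-- A tree-structured Boolean circuit of depth `d`: every inner node (the levels `0, …, d - 1` of the
full binary tree) carries an arbitrary gate `{±1}² → {±1}`; the leaves are the `2 ^ d` input bits. -/
structure TreeCircuit (d : ℕ) where
  gate : (i : Fin d) → Fin (2 ^ (i : ℕ)) → (Fin 2 → Bool) → Bool

namespace TreeCircuit

variable {d : ℕ}

/-- The function `{±1}^(2^(i+1)) → {±1}^(2^i)` computed by the gates of level `i`. -/
def layer (C : TreeCircuit d) (i : Fin d) (x : Fin (2 ^ ((i : ℕ) + 1)) → Bool) :
    Fin (2 ^ (i : ℕ)) → Bool :=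
  fun j => C.gate i j (fun c => x (child j c))

/-- The composed function from the values on level `i'` to the values on level `i ≤ i'`. -/
def comp (C : TreeCircuit d) {i i' : ℕ} (h : i ≤ i') (h' : i' ≤ d) (x : Fin (2 ^ i') → Bool) :
    Fin (2 ^ i) → Bool :=
  Nat.decreasingInduction (motive := fun m _ => Fin (2 ^ m) → Bool)
    (fun m hm z => C.layer ⟨m, hm.trans_le h'⟩ z) x h

/-- The Boolean function computed by the circuit. -/
def eval (C : TreeCircuit d) (x : Fin (2 ^ d) → Bool) : Bool :=
  C.comp (Nat.zero_le d) le_rfl x 0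

/-- The influence of the `j`-th node of level `i`: the fraction of the assignments `x` of level `i`
for which flipping `x j` changes the output of the circuit. -/
noncomputable def influence (C : TreeCircuit d) {i : ℕ} (hi : i ≤ d) (j : Fin (2 ^ i)) : ℝ :=
  ((Finset.univ.filter fun x : Fin (2 ^ i) → Bool =>
      C.comp (Nat.zero_le i) hi x ≠
        C.comp (Nat.zero_le i) hi (Function.update x j (!x j))).card : ℝ) /
    (Fintype.card (Fin (2 ^ i) → Bool) : ℝ)

end TreeCircuit

/-! ## Distributions of labelled examples -/

/-- A labelled example `(x, y) ∈ {±1}^(2^d) × {±1}`. -/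
abbrev Example (d : ℕ) : Type := (Fin (2 ^ d) → Bool) × Bool

/-- The mean `E[y]` of the label. -/
noncomputable def labelMean {d : ℕ} (D : Measure (Example d)) : ℝ := ∫ z, sgn z.2 ∂D

/-- The correlation of the value of the `j`-th node of level `i` with the label. -/
noncomputable def correlation {d : ℕ} (C : TreeCircuit d) (D : Measure (Example d)) {i : ℕ}
    (hi : i ≤ d) (j : Fin (2 ^ i)) : ℝ :=
  ∫ z, sgn (C.comp hi le_rfl z.1 j) * sgn z.2 ∂D

/-- Local correlation assumption with parameter `Δ`. -/
def LCA {d : ℕ} (C : TreeCircuit d) (D : Measure (Example d)) (Δ : ℝ) : Prop :=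
  ∀ (i : ℕ) (_ : 1 ≤ i) (hi : i ≤ d) (j : Fin (2 ^ i)),
    C.influence hi j ≠ 0 → labelMean D + Δ < |correlation C D hi j|

/-- `Δ`-non-degenerate product distribution: the input bits are independent and each of them is `+1`
with probability in `(Δ, 1 - Δ)`. -/
def NondegenerateProduct {d : ℕ} (D : Measure (Example d)) (Δ : ℝ) : Prop :=
  iIndepFun (fun (j : Fin (2 ^ d)) (z : Example d) => z.1 j) D ∧
    ∀ j, D.real {z | z.1 j = true} ∈ Set.Ioo Δ (1 - Δ)

/-- `D` is separable by the function computed by `C`. -/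
def SeparableBy {d : ℕ} (C : TreeCircuit d) (D : Measure (Example d)) : Prop :=
  ∀ᵐ z ∂D, z.2 = C.eval z.1

/-! ## Neural gates, blocks and the loss -/

/-- The ReLU activation. -/
noncomputable def relu (t : ℝ) : ℝ := max t 0

/-- The hard-tanh activation. -/
noncomputable def hardTanh (t : ℝ) : ℝ := max (min t 1) (-1)

/-- The input of the output node of a neural gate of width `k`, `∑ₗ vₗ σ(⟨wₗ, u⟩)`. -/
noncomputable def preact {k : ℕ} (w : Fin k → Fin 2 → ℝ) (v : Fin k → ℝ) (u : Fin 2 → ℝ) : ℝ :=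
  ∑ l, v l * relu (w l ⬝ᵥ u)

/-- The neural gate `g_{w,v}` of width `k`. -/
noncomputable def neuralGate {k : ℕ} (w : Fin k → Fin 2 → ℝ) (v : Fin k → ℝ) (u : Fin 2 → ℝ) : ℝ :=
  hardTanh (preact w v u)

/-- The pair of inputs of the `j`-th gate. -/
def inputs {i : ℕ} (x : Fin (2 ^ (i + 1)) → ℝ) (j : Fin (2 ^ i)) : Fin 2 → ℝ :=
  fun c => x (child j c)

/-- A block of `2 ^ i` neural gates. -/
noncomputable def block {i k : ℕ} (W : Fin (2 ^ i) → Fin k → Fin 2 → ℝ)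
    (V : Fin (2 ^ i) → Fin k → ℝ) (x : Fin (2 ^ (i + 1)) → ℝ) : Fin (2 ^ i) → ℝ :=
  fun j => neuralGate (W j) (V j) (inputs x j)

/-- Average pooling. -/
noncomputable def avgPool {n : ℕ} (x : Fin n → ℝ) : ℝ := (1 / (n : ℝ)) * ∑ j, x j

/-- The hinge loss plus the regularization term `λ |1 + ŷ|`. -/
noncomputable def loss (lam yhat y : ℝ) : ℝ := max (1 - y * yhat) 0 + lam * |1 + yhat|

/-- The empirical loss `L_S(f)` of a real-valued predictor. -/
noncomputable def empLoss {d m : ℕ} (lam : ℝ) (S : Fin m → Example d)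
    (f : (Fin (2 ^ d) → ℝ) → ℝ) : ℝ :=
  (1 / (m : ℝ)) * ∑ s, loss lam (f (fun a => sgn ((S s).1 a))) (sgn (S s).2)

/-! ## Layerwise gradient descent -/

/-- The gradient with respect to `W` of the empirical loss `L_S(P(B_{W,V} ∘ N))`, computed by the
chain rule. The derivatives of the loss, of hard-tanh and of ReLU at their kinks are `0` (the value
that `deriv` takes at a point of non-differentiability). -/
noncomputable def layerGrad {d m i k : ℕ} (lam : ℝ) (S : Fin m → Example d)
    (N : (Fin (2 ^ d) → ℝ) → Fin (2 ^ (i + 1)) → ℝ) (V : Fin (2 ^ i) → Fin k → ℝ)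
    (W : Fin (2 ^ i) → Fin k → Fin 2 → ℝ) : Fin (2 ^ i) → Fin k → Fin 2 → ℝ :=
  fun j l c => (1 / (m : ℝ)) * ∑ s,
    let z := N (fun a => sgn ((S s).1 a))
    let u := inputs z j
    deriv (fun t => loss lam t (sgn (S s).2)) (avgPool (block W V z)) *
      ((1 / ((2 ^ i : ℕ) : ℝ)) *
        (deriv hardTanh (preact (W j) (V j) u) * (V j l * (deriv relu (W j l ⬝ᵥ u) * u c))))

/-- Away from the kinks, `layerGrad` is the vector of partial derivatives of the empirical loss. -/
theorem hasDerivAt_empLoss {d m i k : ℕ} (lam : ℝ) (S : Fin m → Example d)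
    (N : (Fin (2 ^ d) → ℝ) → Fin (2 ^ (i + 1)) → ℝ) (V : Fin (2 ^ i) → Fin k → ℝ)
    (W : Fin (2 ^ i) → Fin k → Fin 2 → ℝ) (j : Fin (2 ^ i)) (l : Fin k) (c : Fin 2)
    (h₁ : ∀ s, DifferentiableAt ℝ (fun t => loss lam t (sgn (S s).2))
      (avgPool (block W V (N (fun a => sgn ((S s).1 a))))))
    (h₂ : ∀ s, DifferentiableAt ℝ hardTanh
      (preact (W j) (V j) (inputs (N (fun a => sgn ((S s).1 a))) j)))
    (h₃ : ∀ s, DifferentiableAt ℝ relu (W j l ⬝ᵥ inputs (N (fun a => sgn ((S s).1 a))) j)) :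
    HasDerivAt (fun t => empLoss lam S fun x => avgPool (block
        (Function.update W j (Function.update (W j) l (Function.update (W j l) c t))) V (N x)))
      (layerGrad lam S N V W j l c) (W j l c) := by
  have key : ∀ u : Fin 2 → ℝ, HasDerivAt
      (fun t => Function.update (W j l) c t ⬝ᵥ u) (u c) (W j l c) := by
    intro u
    have h : ∀ t, Function.update (W j l) c t ⬝ᵥ u = W j l ⬝ᵥ u + (t - W j l c) * u c := by
      intro t
      fin_cases c <;> simp [dotProduct, Fin.sum_univ_two] <;> ring
    simp_rw [h]
    simpa using (((hasDerivAt_id (W j l c)).sub_const (W j l c)).mul_const (u c)).const_add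
      (W j l ⬝ᵥ u)
  unfold empLoss layerGrad
  refine HasDerivAt.const_mul _ (HasDerivAt.fun_sum fun s _ => ?_)
  set z := N (fun a => sgn ((S s).1 a)) with hz
  have e0 : Function.update W j (Function.update (W j) l (Function.update (W j l) c (W j l c))) = W := by
    simp
  have e1 : Function.update (W j) l (Function.update (W j l) c (W j l c)) = W j := by simp
  have e2 : Function.update (W j l) c (W j l c) = W j l := by simp
  have hr : HasDerivAt (fun t => relu (Function.update (W j l) c t ⬝ᵥ inputs z j))
      (deriv relu (W j l ⬝ᵥ inputs z j) * inputs z j c) (W j l c) := by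
    have h := (h₃ s).hasDerivAt
    rw [← hz] at h
    exact HasDerivAt.comp (W j l c) (h₂ := relu) (by rw [e2]; exact h) (key _)
  have hp : HasDerivAt (fun t => preact
      (Function.update (W j) l (Function.update (W j l) c t)) (V j) (inputs z j))
      (V j l * (deriv relu (W j l ⬝ᵥ inputs z j) * inputs z j c)) (W j l c) := by
    unfold preact
    have h := HasDerivAt.fun_sum (u := Finset.univ) (x := W j l c)
      (A := fun l' t => V j l' *
        relu (Function.update (W j) l (Function.update (W j l) c t) l' ⬝ᵥ inputs z j))
      (A' := fun l' => if l' = l then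
        V j l * (deriv relu (W j l ⬝ᵥ inputs z j) * inputs z j c) else 0) (fun l' _ => by
        by_cases hl : l' = l
        · subst hl
          simpa using hr.const_mul (V j l')
        · simpa [hl] using hasDerivAt_const (W j l c) (V j l' * relu (W j l' ⬝ᵥ inputs z j)))
    simpa using h
  have hg : HasDerivAt (fun t => neuralGate
      (Function.update (W j) l (Function.update (W j l) c t)) (V j) (inputs z j))
      (deriv hardTanh (preact (W j) (V j) (inputs z j)) *
        (V j l * (deriv relu (W j l ⬝ᵥ inputs z j) * inputs z j c))) (W j l c) := by
    have h := (h₂ s).hasDerivAt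
    rw [← hz] at h
    exact HasDerivAt.comp (W j l c) (h₂ := hardTanh) (by rw [e1]; exact h) hp
  have ha : HasDerivAt (fun t => avgPool (block
      (Function.update W j (Function.update (W j) l (Function.update (W j l) c t))) V z))
      ((1 / ((2 ^ i : ℕ) : ℝ)) * (deriv hardTanh (preact (W j) (V j) (inputs z j)) *
        (V j l * (deriv relu (W j l ⬝ᵥ inputs z j) * inputs z j c)))) (W j l c) := by
    unfold avgPool
    refine HasDerivAt.const_mul _ ?_
    have h := HasDerivAt.fun_sum (u := Finset.univ) (x := W j l c)
      (A := fun j' t => block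
        (Function.update W j (Function.update (W j) l (Function.update (W j l) c t))) V z j')
      (A' := fun j' => if j' = j then
        deriv hardTanh (preact (W j) (V j) (inputs z j)) *
        (V j l * (deriv relu (W j l ⬝ᵥ inputs z j) * inputs z j c)) else 0) (fun j' _ => by
        by_cases hj : j' = j
        · subst hj
          simpa [block] using hg
        · simpa [block, hj] using
            hasDerivAt_const (W j l c) (neuralGate (W j') (V j') (inputs z j')))
    simpa using h
  have h := (h₁ s).hasDerivAt
  rw [← hz] at h
  exact HasDerivAt.comp (W j l c) (h₂ := fun t => loss lam t (sgn (S s).2))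
    (by rw [e0]; exact h) ha

/-- `T` gradient steps with learning rate `η` on the first-layer weights of one block, on top of the
fixed network `N`. -/
noncomputable def trainLayer {d m i k : ℕ} (lam η : ℝ) (T : ℕ) (S : Fin m → Example d)
    (N : (Fin (2 ^ d) → ℝ) → Fin (2 ^ (i + 1)) → ℝ) (V : Fin (2 ^ i) → Fin k → ℝ)
    (W₀ : Fin (2 ^ i) → Fin k → Fin 2 → ℝ) : Fin (2 ^ i) → Fin k → Fin 2 → ℝ :=
  (fun W => W - η • layerGrad lam S N V W)^[T] W₀

/-- The hidden neurons of the network: `k` of them for every gate of the tree of depth `d`. -/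
abbrev Neuron (d k : ℕ) : Type := (i : Fin d) × Fin (2 ^ (i : ℕ)) × Fin k

/-- Layerwise gradient descent from the initialization `W₀, V₀`: the network with outputs on level `i`
that is obtained after training the blocks of the levels `d - 1, …, i` in this order. -/
noncomputable def trainedTo {d m k : ℕ} (lam η : ℝ) (T : ℕ) (S : Fin m → Example d)
    (W₀ : Neuron d k → Fin 2 → ℝ) (V₀ : Neuron d k → Bool) {i : ℕ} (hi : i ≤ d) :
    (Fin (2 ^ d) → ℝ) → Fin (2 ^ i) → ℝ :=
  Nat.decreasingInduction (motive := fun i _ => (Fin (2 ^ d) → ℝ) → Fin (2 ^ i) → ℝ)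
    (fun i hi N =>
      let V : Fin (2 ^ i) → Fin k → ℝ := fun j l => sgn (V₀ ⟨⟨i, hi⟩, j, l⟩)
      let W := trainLayer lam η T S N V (fun j l => W₀ ⟨⟨i, hi⟩, j, l⟩)
      fun x => block W V (N x))
    id hi

/-- The real-valued function on `{±1}^(2^d)` that layerwise gradient descent returns. -/
noncomputable def trainedNet {d m k : ℕ} (lam η : ℝ) (T : ℕ) (S : Fin m → Example d)
    (W₀ : Neuron d k → Fin 2 → ℝ) (V₀ : Neuron d k → Bool) (x : Fin (2 ^ d) → Bool) : ℝ :=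
  trainedTo lam η T S W₀ V₀ (Nat.zero_le d) (fun a => sgn (x a)) 0

/-! ## Random initialization -/

/-- Admissible law of the initial first-layer weight vector of one hidden neuron: all coordinates are
at most `r` in absolute value, and each of the four patterns `p ∈ {±1}²` activates the neuron with
probability `1 / 2` (for instance, the uniform law on `[-r, r]²` for `r > 0`). -/
structure IsInitLaw (r : ℝ) (μ : Measure (Fin 2 → ℝ)) : Prop where
  isProbabilityMeasure : IsProbabilityMeasure μ
  bounded : ∀ᵐ w ∂μ, ∀ c, |w c| ≤ r
  balanced : ∀ p : Fin 2 → Bool, μ {w | 0 < w ⬝ᵥ fun c => sgn (p c)} = 1 / 2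

/-- The joint law of the sample (`m` independent draws from `D`), the initial first-layer weights
(independent, with the laws `μ`) and the second-layer weights (independent uniform signs). -/
noncomputable def runLaw {d k : ℕ} (m : ℕ) (D : Measure (Example d))
    (μ : Neuron d k → Measure (Fin 2 → ℝ)) :
    Measure ((Fin m → Example d) × (Neuron d k → Fin 2 → ℝ) × (Neuron d k → Bool)) :=
  (Measure.pi fun _ => D).prod
    ((Measure.pi μ).prod (Measure.pi fun _ => uniformOn (Set.univ : Set Bool)))

/-! ## Structure of tree circuits -/

/-! Training succeeds because each trained layer agrees, on the whole cube, with a fixed ideal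
network (`ideal`) that depends on the distribution but not on the sample. In it an irrelevant node
outputs -1, and a relevant node outputs its circuit value up to the sign of its correlation with the
label. At the root that correlation is 1, so the ideal root is the circuit itself (`ideal_root`).

Gradient. If a gate is not saturated on an example, the average over all gates lies strictly inside
(-1, 1), where the loss is affine with slope `λ - y`. Hence on sign inputs the gradient of a gate is
a sum over the four patterns `p` of the empirical mean of `(λ - y) 1_p` (`layerGrad_eq`). Patterns
that are neither equal nor opposite are orthogonal, so the dynamics split into pairs `p, -p`
(`pairDynamics_trainLayer`). In such a pair, neurons with the right output weight grow, those with
the wrong one stay small, and after enough steps the gate saturates with the sign of the mean of `(y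
- λ) 1_p` (`PairDynamics.one_le_gateSum`).

Margin. The bits below a node are independent of the others. Given the pattern, the output therefore
behaves as if the node were overwritten by a constant, and the population mean of `(y - λ) 1_p`
factors as the probability of `p` times (forced mean minus `λ`). At an irrelevant node the forced
mean is `E[y]`, below `λ` by `Δ/4`; this is what the regularizer is for. At a relevant node local
correlation puts the two forced means on either side of `λ`, at distance at least `Δ/4`. Patterns
that occur have probability at least `Δ²/4`, so the margin is `Δ³/16` (`pattern_margin`).

Probability. Since the ideal gates do not depend on the sample, one sample serves all layers:
Hoeffding's inequality and a union bound over the `n - 1` gates and four patterns suffice. Each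
pattern must also activate, initially, a neuron with the right output weight
(`measureReal_iUnion_uncovered_le`). On these events induction from the leaves
(`trainedTo_eq_ideal`) identifies the trained network with the ideal one. -/

theorem sgn_true : sgn true = 1 := rfl

theorem sgn_false : sgn false = -1 := rfl

theorem sgn_mul_self (b : Bool) : sgn b * sgn b = 1 := by cases b <;> simp [sgn]

theorem sgn_not (b : Bool) : sgn (!b) = -sgn b := by cases b <;> simp [sgn]

theorem abs_sgn (b : Bool) : |sgn b| = 1 := by cases b <;> simp [sgn]

theorem child_div {i : ℕ} (j : Fin (2 ^ i)) (c : Fin 2) : (child j c).1 / 2 = j.1 := by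
  have := c.2
  simp only [child]
  omega

theorem child_injective {i : ℕ} (j : Fin (2 ^ i)) : Function.Injective (child j) := by
  intro a b h
  simp only [child, Fin.mk.injEq] at h
  omega

theorem child_eq_child_iff {i : ℕ} {j j' : Fin (2 ^ i)} {c c' : Fin 2} :
    child j c = child j' c' ↔ j = j' ∧ c = c' := by
  refine ⟨fun h => ?_, fun ⟨h, h'⟩ => by rw [h, h']⟩
  have hj : j = j' := by
    apply Fin.ext
    rw [← child_div j c, h, child_div]
  subst hj
  exact ⟨rfl, child_injective j h⟩

namespace TreeCircuit

variable {d : ℕ} (C : TreeCircuit d)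

theorem comp_self {i : ℕ} (h : i ≤ d) (x : Fin (2 ^ i) → Bool) : C.comp le_rfl h x = x := by
  unfold comp
  rw [Nat.decreasingInduction_self]

theorem comp_succ {i i' : ℕ} (h : i < i') (h' : i' ≤ d) (x : Fin (2 ^ i') → Bool) :
    C.comp h.le h' x = C.layer ⟨i, h.trans_le h'⟩ (C.comp (Nat.succ_le_of_lt h) h' x) := by
  unfold comp
  rw [Nat.decreasingInduction_succ_left (smn := h)]

theorem comp_comp {i i' i'' : ℕ} (h : i ≤ i') (h' : i' ≤ i'') (h'' : i'' ≤ d)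
    (x : Fin (2 ^ i'') → Bool) :
    C.comp h (h'.trans h'') (C.comp h' h'' x) = C.comp (h.trans h') h'' x := by
  unfold comp
  rw [Nat.decreasingInduction_trans (hmn := h) (hnk := h')]

/-- The value of the `j`-th node of level `i` on an input of the circuit. -/
def val {i : ℕ} (hi : i ≤ d) (x : Fin (2 ^ d) → Bool) (j : Fin (2 ^ i)) : Bool :=
  C.comp hi le_rfl x j

/-- The output of the circuit as a function of the values of level `i`. -/
def top {i : ℕ} (hi : i ≤ d) (y : Fin (2 ^ i) → Bool) : Bool :=
  C.comp (Nat.zero_le i) hi y 0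

theorem val_depth (x : Fin (2 ^ d) → Bool) (j : Fin (2 ^ d)) : C.val le_rfl x j = x j := by
  unfold val
  rw [comp_self]

theorem val_succ {i : ℕ} (hi : i < d) (x : Fin (2 ^ d) → Bool) (j : Fin (2 ^ i)) :
    C.val hi.le x j = C.gate ⟨i, hi⟩ j (fun c => C.val (Nat.succ_le_of_lt hi) x (child j c)) := by
  unfold val
  rw [comp_succ C hi]
  rfl

theorem top_zero (y : Fin (2 ^ 0) → Bool) : C.top (Nat.zero_le d) y = y 0 := by
  unfold top
  rw [comp_self]

theorem top_succ {i : ℕ} (hi : i < d) (y : Fin (2 ^ (i + 1)) → Bool) :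
    C.top (Nat.succ_le_of_lt hi) y = C.top hi.le (C.layer ⟨i, hi⟩ y) := by
  unfold top
  rw [← comp_comp C (Nat.zero_le i) (Nat.le_succ i), comp_succ C (Nat.lt_succ_self i), comp_self]

theorem top_val {i : ℕ} (hi : i ≤ d) (x : Fin (2 ^ d) → Bool) :
    C.top hi (C.val hi x) = C.eval x := by
  unfold top eval
  rw [← comp_comp C (Nat.zero_le i) hi]
  rfl

theorem val_zero (x : Fin (2 ^ d) → Bool) (j : Fin (2 ^ 0)) :
    C.val (Nat.zero_le d) x j = C.eval x := by
  have : j = 0 := Subsingleton.elim (α := Fin 1) _ _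
  rw [this]
  rfl

/-- A node is relevant if the output, as a function of the values of its level, depends on it. -/
def Relevant {i : ℕ} (hi : i ≤ d) (j : Fin (2 ^ i)) : Prop :=
  ∃ y, C.top hi (Function.update y j true) ≠ C.top hi (Function.update y j false)

theorem top_update_of_not_relevant {i : ℕ} {hi : i ≤ d} {j : Fin (2 ^ i)} (h : ¬C.Relevant hi j)
    (y : Fin (2 ^ i) → Bool) (b : Bool) : C.top hi (Function.update y j b) = C.top hi y := by
  unfold Relevant at h
  push Not at h
  have h1 := h y
  have h2 : Function.update y j (y j) = y := Function.update_eq_self j y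
  conv_rhs => rw [← h2]
  cases b <;> cases y j <;> simp [h1]

theorem comp_ne_comp_iff {i : ℕ} (hi : i ≤ d) (x y : Fin (2 ^ i) → Bool) :
    C.comp (Nat.zero_le i) hi x ≠ C.comp (Nat.zero_le i) hi y ↔ C.top hi x ≠ C.top hi y := by
  rw [not_iff_not]
  refine ⟨fun h => congrFun h 0, fun h => funext fun j => ?_⟩
  have : j = 0 := Subsingleton.elim (α := Fin 1) _ _
  rw [this]
  exact h

theorem influence_ne_zero_iff {i : ℕ} (hi : i ≤ d) (j : Fin (2 ^ i)) :
    C.influence hi j ≠ 0 ↔ C.Relevant hi j := by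
  have hc : (Fintype.card (Fin (2 ^ i) → Bool) : ℝ) ≠ 0 := by
    exact_mod_cast Fintype.card_ne_zero
  unfold influence
  rw [ne_eq, div_eq_zero_iff, not_or, and_iff_left hc, Nat.cast_eq_zero, Finset.card_eq_zero,
    ← ne_eq, ← Finset.nonempty_iff_ne_empty]
  constructor
  · rintro ⟨x, hx⟩
    rw [Finset.mem_filter, comp_ne_comp_iff] at hx
    by_contra h
    exact hx.2 (C.top_update_of_not_relevant h x _).symm
  · rintro ⟨y, hy⟩
    refine ⟨Function.update y j true, ?_⟩
    rw [Finset.mem_filter, comp_ne_comp_iff]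
    simpa using hy

/-- The leaves below the `j`-th node of level `i`. -/
def leaves (d : ℕ) {i : ℕ} (j : Fin (2 ^ i)) : Finset (Fin (2 ^ d)) :=
  Finset.univ.filter fun a => a.1 / 2 ^ (d - i) = j.1

theorem mem_leaves {i : ℕ} {j : Fin (2 ^ i)} {a : Fin (2 ^ d)} :
    a ∈ leaves d j ↔ a.1 / 2 ^ (d - i) = j.1 := by
  simp [leaves]

theorem disjoint_leaves {i : ℕ} {j j' : Fin (2 ^ i)} (h : j ≠ j') :
    Disjoint (leaves d j) (leaves d j') := by
  rw [Finset.disjoint_left]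
  intro a ha ha'
  rw [mem_leaves] at ha ha'
  exact h (Fin.ext (ha.symm.trans ha'))

theorem leaves_child_subset {i : ℕ} (hi : i < d) (j : Fin (2 ^ i)) (c : Fin 2) :
    leaves d (child j c) ⊆ leaves d j := by
  intro a ha
  rw [mem_leaves] at ha ⊢
  have : d - i = (d - (i + 1)) + 1 := by omega
  rw [this, pow_succ, ← Nat.div_div_eq_div_mul, ha, child_div]

theorem val_congr {i : ℕ} (hi : i ≤ d) {x x' : Fin (2 ^ d) → Bool} (j : Fin (2 ^ i))
    (h : ∀ a ∈ leaves d j, x a = x' a) : C.val hi x j = C.val hi x' j := by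
  induction hi using Nat.decreasingInduction with
  | self =>
    rw [val_depth, val_depth]
    exact h j (by simp [mem_leaves])
  | of_succ i hi ih =>
    rw [val_succ C hi, val_succ C hi]
    congr 1
    funext c
    exact ih _ fun a ha => h a (leaves_child_subset hi j c ha)

/-- The output after overwriting the value of one node depends only on the leaves that are not below
this node. -/
theorem top_update_val_congr {i : ℕ} (hi : i ≤ d) {x x' : Fin (2 ^ d) → Bool} (j : Fin (2 ^ i))
    (b : Bool) (h : ∀ a ∉ leaves d j, x a = x' a) :
    C.top hi (Function.update (C.val hi x) j b) = C.top hi (Function.update (C.val hi x') j b) := by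
  congr 1
  funext j'
  by_cases hj : j' = j
  · subst hj
    simp
  · rw [Function.update_of_ne hj, Function.update_of_ne hj]
    exact C.val_congr hi j' fun a ha => h a fun ha' =>
      Finset.disjoint_left.1 (disjoint_leaves hj) ha ha'

/-- If the output on some input is sensitive to the value of a node, the gate of this node does not
depend on its irrelevant children. -/
theorem gate_congr_of_sensitive {i : ℕ} (hi : i < d) (j : Fin (2 ^ i)) {x₀ : Fin (2 ^ d) → Bool}
    (hx₀ : C.top hi.le (Function.update (C.val hi.le x₀) j true) ≠
      C.top hi.le (Function.update (C.val hi.le x₀) j false))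
    {p q : Fin 2 → Bool} (hpq : ∀ c, C.Relevant (Nat.succ_le_of_lt hi) (child j c) → p c = q c) :
    C.gate ⟨i, hi⟩ j p = C.gate ⟨i, hi⟩ j q := by
  set y : Fin (2 ^ (i + 1)) → Bool := C.val (Nat.succ_le_of_lt hi) x₀
  -- the level below, with the children of `j` overwritten
  let Y : (Fin 2 → Bool) → Fin (2 ^ (i + 1)) → Bool := fun r =>
    Function.update (Function.update y (child j 0) (r 0)) (child j 1) (r 1)
  have h01 : child j 0 ≠ child j 1 := fun h => by simpa using child_injective j h
  have hYc : ∀ r c, Y r (child j c) = r c := by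
    intro r c
    fin_cases c
    · simp [Y, Function.update_of_ne h01]
    · simp [Y]
  have hlayer : ∀ r, C.layer ⟨i, hi⟩ (Y r) =
      Function.update (C.val hi.le x₀) j (C.gate ⟨i, hi⟩ j r) := by
    intro r
    funext j'
    by_cases hj : j' = j
    · subst hj
      simp only [layer, Function.update_self, hYc]
    · have hne : ∀ c c', child j' c ≠ child j c' := fun c c' h => hj (child_eq_child_iff.1 h).1
      simp only [layer, Function.update_of_ne hj, Y, Function.update_of_ne (hne _ _), C.val_succ hi]
      rfl
  have htop : ∀ r, C.top (Nat.succ_le_of_lt hi) (Y r) =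
      C.top hi.le (Function.update (C.val hi.le x₀) j (C.gate ⟨i, hi⟩ j r)) := by
    intro r
    rw [top_succ C hi, hlayer]
  -- The children change from `p` to `q` one at a time: at a relevant child nothing changes, and an
  -- irrelevant one cannot affect the output.
  have hY : C.top (Nat.succ_le_of_lt hi) (Y p) = C.top (Nat.succ_le_of_lt hi) (Y q) := by
    have hstep : ∀ (z : Fin (2 ^ (i + 1)) → Bool) (c : Fin 2),
        C.top (Nat.succ_le_of_lt hi) (Function.update z (child j c) (p c)) =
          C.top (Nat.succ_le_of_lt hi) (Function.update z (child j c) (q c)) := by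
      intro z c
      by_cases hc : C.Relevant (Nat.succ_le_of_lt hi) (child j c)
      · rw [hpq c hc]
      · rw [top_update_of_not_relevant C hc, top_update_of_not_relevant C hc]
    simp only [Y]
    rw [hstep, Function.update_comm h01, Function.update_comm h01, hstep]
  -- If the gate values at `p` and `q` differed, `hY` would contradict the sensitivity at `x₀`.
  rw [htop, htop] at hY
  by_contra hne
  revert hY hx₀ hne
  cases C.gate ⟨i, hi⟩ j p <;> cases C.gate ⟨i, hi⟩ j q <;> intro a b c
  all_goals first | exact c rfl | exact a b | exact a b.symm

end TreeCircuit

/-! ## Gradient dynamics of one neural gate along a pair of opposite patterns -/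

theorem relu_nonneg (t : ℝ) : 0 ≤ relu t := le_max_right _ _

theorem le_relu (t : ℝ) : t ≤ relu t := le_max_left _ _

theorem relu_le {t M : ℝ} (hM : 0 ≤ M) (h : t ≤ M) : relu t ≤ M := max_le h hM

/-- The output of a neural gate, before the hard-tanh, on a pattern with which the weights of its
hidden neurons have the inner products `a`. -/
noncomputable def gateSum {k : ℕ} (v a : Fin k → ℝ) : ℝ := ∑ l, v l * relu (a l)

/-- `a t l` is the inner product of the `l`-th weight vector with a pattern `p` after `t` gradient
steps; `β` and `β'` are the signed sizes of the updates at the patterns `p` and `-p`. -/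
def PairDynamics {k : ℕ} (v : Fin k → ℝ) (β β' : ℝ) (a : ℕ → Fin k → ℝ) : Prop :=
  ∀ t l, a (t + 1) l = a t l + 2 * v l *
    ((if 0 < a t l ∧ |gateSum v (a t)| < 1 then β else 0) -
      (if a t l < 0 ∧ |gateSum v (-a t)| < 1 then β' else 0))

namespace PairDynamics

variable {k : ℕ} {v : Fin k → ℝ} {β β' : ℝ} {a : ℕ → Fin k → ℝ}

/-- The roles of `p` and `-p` are symmetric, so every bound for one pattern transfers to the other.
-/
theorem neg (h : PairDynamics v β β' a) : PairDynamics v β' β (-a) := by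
  intro t l
  have := h t l
  simp only [Pi.neg_apply, neg_neg, Left.neg_pos_iff, Left.neg_neg_iff] at this ⊢
  rw [this]
  ring

variable {s κ M : ℝ}

/-- A neuron whose output weight has the wrong sign stays small. -/
theorem bad_le (h : PairDynamics v β β' a) (hs : s = 1 ∨ s = -1) (hβ : 0 ≤ s * β)
    (hM : 0 ≤ M) (hβM' : |β'| ≤ M / 2) (h₀ : ∀ l, |a 0 l| ≤ M) {l : Fin k} (hl : v l = -s) (t : ℕ) :
    a t l ≤ M := by
  induction t with
  | zero => exact (le_abs_self _).trans (h₀ l)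
  | succ t ih =>
    rw [h t l, hl]
    have h1 := abs_le.1 hβM'
    -- On the negative side one step raises the value by at most `2|β'| ≤ M`, so it cannot jump
    -- above `M`; on the positive side the wrong output weight makes every step downward.
    rcases lt_trichotomy (a t l) 0 with hlt | heq | hgt
    · rw [if_neg (fun hc => absurd hc.1 hlt.not_gt)]
      split_ifs
      · rcases hs with rfl | rfl <;> linarith [h1.1, h1.2]
      · linarith
    · simp [heq, hM]
    · rw [if_neg (c := a t l < 0 ∧ _) (fun hc => absurd hc.1 hgt.not_gt)]
      split_ifs
      · linarith
      · linarith

/-- The number of the first `t` steps in which the gate is not saturated. -/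
noncomputable def activeCount (v : Fin k → ℝ) (a : ℕ → Fin k → ℝ) (t : ℕ) : ℕ :=
  ((Finset.range t).filter fun τ => |gateSum v (a τ)| < 1).card

theorem activeCount_succ (v : Fin k → ℝ) (a : ℕ → Fin k → ℝ) (t : ℕ) :
    activeCount v a (t + 1) = activeCount v a t + if |gateSum v (a t)| < 1 then 1 else 0 := by
  unfold activeCount
  rw [Finset.range_add_one, Finset.filter_insert]
  split_ifs
  · rw [Finset.card_insert_of_notMem (by simp)]
  · rfl

/-- A neuron whose output weight has the right sign grows in every active step. -/
theorem good_ge (h : PairDynamics v β β' a) (hκ : 0 ≤ κ) (hβ : κ ≤ s * β)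
    {l : Fin k} (hl : v l = s) (hpos : 0 < a 0 l) (t : ℕ) :
    0 < a t l ∧ 2 * κ * activeCount v a t ≤ a t l := by
  induction t with
  | zero => simpa [activeCount] using ⟨hpos, hpos.le⟩
  | succ t ih =>
    rw [h t l, hl, activeCount_succ, if_neg (c := a t l < 0 ∧ _) (fun hc => absurd hc.1 ih.1.not_gt)]
    have := ih.1
    split_ifs with h1 h2
    · push_cast
      constructor <;> linarith
    · exact absurd h1.2 h2
    · exact absurd ⟨ih.1, by assumption⟩ h1
    · simpa using ih

/-- The output is at least the contribution of any right neuron, minus a bound for the wrong ones. -/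
theorem sub_le_gateSum {b : Fin k → ℝ} (hv : ∀ l, v l = 1 ∨ v l = -1) (hs : s = 1 ∨ s = -1)
    (hM : 0 ≤ M) (hb : ∀ l, v l = -s → b l ≤ M) {l : Fin k} (hl : v l = s) :
    b l - k * M ≤ s * gateSum v b := by
  unfold gateSum
  rw [Finset.mul_sum, ← Finset.add_sum_erase _ _ (Finset.mem_univ l)]
  have h1 : b l ≤ s * (v l * relu (b l)) := by
    rw [hl, ← mul_assoc]
    rcases hs with rfl | rfl <;> simpa using le_relu (b l)
  have h2 : -(k * M) ≤ ∑ l' ∈ Finset.univ.erase l, s * (v l' * relu (b l')) := by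
    have : ∑ l' ∈ Finset.univ.erase l, (-M) ≤
        ∑ l' ∈ Finset.univ.erase l, s * (v l' * relu (b l')) := by
      refine Finset.sum_le_sum fun l' _ => ?_
      have h0 := relu_nonneg (b l')
      by_cases hl' : v l' = -s
      · have := relu_le hM (hb l' hl')
        rw [hl']
        rcases hs with rfl | rfl <;> linarith
      · have : v l' = s := by
          rcases hs with rfl | rfl <;> rcases hv l' with h' | h' <;> rw [h'] at hl' ⊢ <;>
            norm_num at hl'
        rw [this]
        rcases hs with rfl | rfl <;> linarith
    refine le_trans ?_ this
    rw [Finset.sum_const, nsmul_eq_mul, Finset.card_erase_of_mem (Finset.mem_univ l),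
      Finset.card_univ, Fintype.card_fin]
    have : ((k - 1 : ℕ) : ℝ) ≤ k := by exact_mod_cast Nat.sub_le _ _
    nlinarith
  linarith

/-- While the gate is active its signed output is below 1, which by `sub_le_gateSum` keeps a right
neuron below `1 + kM`; but that neuron gains `2κ` in each active step. The extra `2κ` pays for the
last active step. -/
theorem activeCount_le (h : PairDynamics v β β' a) (hv : ∀ l, v l = 1 ∨ v l = -1)
    (hs : s = 1 ∨ s = -1) (hκ : 0 < κ) (hβ : κ ≤ s * β) (hM : 0 ≤ M) (hβM' : |β'| ≤ M / 2)
    (h₀ : ∀ l, |a 0 l| ≤ M) {l : Fin k} (hl : v l = s) (hpos : 0 < a 0 l) (t : ℕ) :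
    2 * κ * activeCount v a t ≤ 1 + k * M + 2 * κ := by
  induction t with
  | zero =>
    simp only [activeCount, Finset.range_zero, Finset.filter_empty, Finset.card_empty, Nat.cast_zero,
      mul_zero]
    positivity
  | succ t ih =>
    rw [activeCount_succ]
    split_ifs with hact
    · have h1 := sub_le_gateSum (b := a t) hv hs hM
        (fun l' hl' => h.bad_le hs (hκ.le.trans hβ) hM hβM' h₀ hl' t) hl
      have h2 := (h.good_ge hκ.le hβ hl hpos t).2
      have h3 := abs_lt.1 hact
      have h4 : s * gateSum v (a t) ≤ 1 := by
        rcases hs with rfl | rfl <;> linarith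
      push_cast
      linarith
    · simpa using ih

/-- Both patterns have to be inactive: saturation at `p` alone can be undone, because updates at
`-p` also move the neurons. -/
theorem eq_of_saturated (h : PairDynamics v β β' a) {t : ℕ} (h1 : 1 ≤ |gateSum v (a t)|)
    (h2 : β' = 0 ∨ 1 ≤ |gateSum v (-a t)|) (r : ℕ) : a (t + r) = a t := by
  induction r with
  | zero => rfl
  | succ r ih =>
    funext l
    rw [← add_assoc, h (t + r) l, ih, if_neg (fun hc => absurd hc.2 h1.not_gt)]
    rcases h2 with h2 | h2
    · simp [h2]
    · rw [if_neg (fun hc => absurd hc.2 h2.not_gt)]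
      simp

/-- After sufficiently many steps, the gate is saturated with the sign of `β`. -/
theorem one_le_gateSum (h : PairDynamics v β β' a) (hv : ∀ l, v l = 1 ∨ v l = -1)
    (hκ : 0 < κ) (hM : 0 ≤ M) (hkM : k * M < 1) (hβM : |β| ≤ M / 2) (hβM' : |β'| ≤ M / 2)
    (h₀ : ∀ l, |a 0 l| ≤ M)
    (hs : s = 1 ∨ s = -1) (hβ : κ ≤ s * β) (hgood : ∃ l, v l = s ∧ 0 < a 0 l)
    (hneg : β' = 0 ∨ ∃ s', (s' = 1 ∨ s' = -1) ∧ κ ≤ s' * β' ∧ ∃ l, v l = s' ∧ a 0 l < 0)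
    {T : ℕ} (hT : 1 + k * M + 2 * κ < κ * T) : 1 ≤ s * gateSum v (a T) := by
  obtain ⟨l, hl, hpos⟩ := hgood
  have hcount := h.activeCount_le hv hs hκ hβ hM hβM' h₀ hl hpos T
  -- at some time, both patterns of the pair are saturated
  obtain ⟨t, htT, ht1, ht2⟩ : ∃ t < T, 1 ≤ |gateSum v (a t)| ∧
      (β' = 0 ∨ 1 ≤ |gateSum v (-a t)|) := by
    -- Pigeonhole: each pattern is active in at most `(1 + kM + 2κ)/(2κ)` steps, and `T` exceeds
    -- twice this number.
    by_contra! hcon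
    rcases hneg with h0 | ⟨s', hs', hβ', l', hl', hpos'⟩
    · have hall : activeCount v a T = T := by
        unfold activeCount
        rw [Finset.filter_true_of_mem, Finset.card_range]
        intro t ht
        by_contra hge
        exact (hcon t (Finset.mem_range.1 ht) (not_lt.1 hge)).1 h0
      rw [hall] at hcount
      have : 0 ≤ k * M := by positivity
      nlinarith
    · have hcount' := h.neg.activeCount_le hv hs' hκ hβ' hM hβM (by simpa using h₀) hl'
        (by simpa using hpos') T
      have hall : T ≤ activeCount v a T + activeCount v (-a) T := by
        unfold activeCount
        refine le_trans ?_ (Finset.card_union_le _ _)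
        rw [← Finset.filter_or, Finset.filter_true_of_mem, Finset.card_range]
        intro t ht
        by_contra hge
        rw [not_or, not_lt] at hge
        exact hge.2 (hcon t (Finset.mem_range.1 ht) hge.1).2
      have hall' : (T : ℝ) ≤ activeCount v a T + activeCount v (-a) T := by exact_mod_cast hall
      nlinarith
  have hfreeze : a T = a t := by
    obtain ⟨r, rfl⟩ := Nat.exists_eq_add_of_lt htT
    exact h.eq_of_saturated ht1 ht2 (r + 1)
  rw [← hfreeze] at ht1
  -- Saturation only gives absolute value at least 1. The sign is decided by the positive right
  -- neuron: the signed output exceeds `-kM > -1`.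
  have h1 := sub_le_gateSum (b := a T) hv hs hM
    (fun l' hl' => h.bad_le hs (hκ.le.trans hβ) hM hβM' h₀ hl' T) hl
  have h2 := (h.good_ge hκ.le hβ hl hpos T).1
  rcases le_abs.1 ht1 with h3 | h3 <;> rcases hs with rfl | rfl <;> linarith

end PairDynamics

/-! ## The gradient on `±1` inputs -/

theorem deriv_relu (t : ℝ) : deriv relu t = if 0 < t then 1 else 0 := by
  rcases lt_trichotomy t 0 with h | h | h
  · rw [if_neg h.not_gt]
    have : relu =ᶠ[nhds t] fun _ => 0 := by
      filter_upwards [gt_mem_nhds h] with x hx using max_eq_right hx.le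
    rw [this.deriv_eq]
    simp
  · subst h
    rw [if_neg (lt_irrefl _)]
    -- Differentiability at the kink would pass to the absolute value, via `|x| = 2 relu x - x`.
    refine deriv_zero_of_not_differentiableAt fun h => not_differentiableAt_abs_zero ?_
    have : (abs : ℝ → ℝ) = fun x => 2 * relu x - x := by
      funext x
      unfold relu
      rcases le_total 0 x with hx | hx
      · rw [abs_of_nonneg hx, max_eq_left hx]; ring
      · rw [abs_of_nonpos hx, max_eq_right hx]; ring
    rw [this]
    exact (h.const_mul 2).sub differentiableAt_id
  · rw [if_pos h]
    have : relu =ᶠ[nhds t] fun x => x := by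
      filter_upwards [lt_mem_nhds h] with x hx using max_eq_left hx.le
    rw [this.deriv_eq]
    simp

/-- This form isolates the two kinks as absolute values, which yields the non-differentiability at
`±1` in `deriv_hardTanh`. -/
theorem hardTanh_eq (t : ℝ) : hardTanh t = (|t + 1| - |t - 1|) / 2 := by
  unfold hardTanh
  rcases le_total t 1 with h1 | h1 <;> rcases le_total (-1) t with h2 | h2
  · rw [min_eq_left h1, max_eq_left h2, abs_of_nonneg (by linarith), abs_of_nonpos (by linarith)]
    ring
  · rw [min_eq_left h1, max_eq_right h2, abs_of_nonpos (by linarith), abs_of_nonpos (by linarith)]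
    ring
  · rw [min_eq_right h1, max_eq_left (by norm_num), abs_of_nonneg (by linarith),
      abs_of_nonneg (by linarith)]
    ring
  · linarith

theorem hardTanh_of_abs_lt {t : ℝ} (h : |t| < 1) : hardTanh t = t := by
  have := abs_lt.1 h
  unfold hardTanh
  rw [min_eq_left this.2.le, max_eq_left this.1.le]

theorem abs_hardTanh_le (t : ℝ) : |hardTanh t| ≤ 1 :=
  abs_le.2 ⟨le_max_right _ _, max_le (min_le_right _ _) (by norm_num)⟩

theorem hardTanh_of_one_le {t : ℝ} (h : 1 ≤ t) : hardTanh t = 1 := by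
  unfold hardTanh
  rw [min_eq_right h, max_eq_left (by norm_num)]

theorem hardTanh_of_le_neg_one {t : ℝ} (h : t ≤ -1) : hardTanh t = -1 := by
  unfold hardTanh
  rw [min_eq_left (by linarith), max_eq_right h]

theorem deriv_hardTanh (t : ℝ) : deriv hardTanh t = if |t| < 1 then 1 else 0 := by
  have habs : ∀ {s : ℝ}, s ≠ 0 → DifferentiableAt ℝ (fun x : ℝ => |x|) s := fun hs =>
    differentiableAt_abs hs
  rcases lt_trichotomy |t| 1 with h | h | h
  · rw [if_pos h]
    have : hardTanh =ᶠ[nhds t] fun x => x := by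
      filter_upwards [(continuous_abs.tendsto t).eventually (gt_mem_nhds h)] with x hx
        using hardTanh_of_abs_lt hx
    rw [this.deriv_eq]
    simp
  · rw [if_neg h.not_lt]
    refine deriv_zero_of_not_differentiableAt fun hd => not_differentiableAt_abs_zero ?_
    have hfun : hardTanh = fun t => (|t + 1| - |t - 1|) / 2 := funext hardTanh_eq
    rcases (abs_eq zero_le_one).1 h with rfl | rfl
    · have e : (abs : ℝ → ℝ) = fun x => |x + 2| - 2 * hardTanh (x + 1) := by
        funext x
        rw [hardTanh_eq]
        ring_nf
      rw [e]
      refine DifferentiableAt.sub ?_ (DifferentiableAt.const_mul ?_ 2)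
      · exact DifferentiableAt.comp (g := fun x : ℝ => |x|) (0 : ℝ) (habs (by norm_num))
          (differentiableAt_id.add_const 2)
      · exact DifferentiableAt.comp (0 : ℝ) (by simpa using hd) (differentiableAt_id.add_const 1)
    · have e : (abs : ℝ → ℝ) = fun x => |x - 2| + 2 * hardTanh (x - 1) := by
        funext x
        rw [hardTanh_eq]
        ring_nf
      rw [e]
      refine DifferentiableAt.add ?_ (DifferentiableAt.const_mul ?_ 2)
      · exact DifferentiableAt.comp (g := fun x : ℝ => |x|) (0 : ℝ) (habs (by norm_num))
          (differentiableAt_id.sub_const 2)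
      · exact DifferentiableAt.comp (0 : ℝ) (by simpa using hd) (differentiableAt_id.sub_const 1)
  · rw [if_neg h.not_gt]
    rcases lt_abs.1 h with h | h
    · have : hardTanh =ᶠ[nhds t] fun _ => 1 := by
        filter_upwards [lt_mem_nhds h] with x hx using hardTanh_of_one_le hx.le
      rw [this.deriv_eq]
      simp
    · have : hardTanh =ᶠ[nhds t] fun _ => -1 := by
        filter_upwards [gt_mem_nhds (lt_neg.1 h)] with x hx using hardTanh_of_le_neg_one hx.le
      rw [this.deriv_eq]
      simp

/-- On (-1, 1) the hinge is active and `1 + t` is positive, so the loss is affine. -/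
theorem deriv_loss (lam : ℝ) (b : Bool) {t : ℝ} (ht : |t| < 1) :
    deriv (fun t => loss lam t (sgn b)) t = lam - sgn b := by
  have : (fun t => loss lam t (sgn b)) =ᶠ[nhds t] fun x => 1 - sgn b * x + lam * (1 + x) := by
    filter_upwards [(continuous_abs.tendsto t).eventually (gt_mem_nhds ht)] with x hx
    have := abs_lt.1 hx
    unfold loss
    rw [abs_of_nonneg (by linarith : 0 ≤ 1 + x), max_eq_left]
    cases b <;> simp only [sgn] <;> norm_num <;> linarith
  rw [this.deriv_eq]
  have h1 : HasDerivAt (fun x : ℝ => 1 - sgn b * x + lam * (1 + x))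
      (-(sgn b * 1) + lam * 1) t :=
    (((hasDerivAt_id t).const_mul (sgn b)).const_sub 1).add
      (((hasDerivAt_id t).const_add 1).const_mul lam)
  rw [h1.deriv]
  ring

/-- A single unsaturated gate keeps the pooled output where the loss is affine. Hence the other
gates never influence the gradient of a given gate. -/
theorem abs_avgPool_lt_one {n : ℕ} {x : Fin n → ℝ} (hx : ∀ j, |x j| ≤ 1) {j : Fin n}
    (hj : |x j| < 1) : |avgPool x| < 1 := by
  have hn : (0 : ℝ) < n := by exact_mod_cast j.pos
  unfold avgPool
  rw [abs_mul, abs_of_pos (by positivity), one_div, inv_mul_lt_iff₀ hn, mul_one]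
  calc |∑ j, x j| ≤ ∑ j, |x j| := Finset.abs_sum_le_sum_abs _ _
    _ < ∑ _j : Fin n, (1 : ℝ) :=
        Finset.sum_lt_sum (fun j _ => hx j) ⟨j, Finset.mem_univ j, hj⟩
    _ = n := by simp

/-- A pattern of two signs as a real vector. -/
def signs (p : Fin 2 → Bool) : Fin 2 → ℝ := fun c => sgn (p c)

/-- The opposite pattern. -/
def opposite (p : Fin 2 → Bool) : Fin 2 → Bool := fun c => !p c

theorem dotProduct_signs_opposite (w : Fin 2 → ℝ) (p : Fin 2 → Bool) :
    w ⬝ᵥ signs (opposite p) = -(w ⬝ᵥ signs p) := by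
  simp only [dotProduct, signs, opposite, Fin.sum_univ_two, sgn_not]
  ring

/-- The two patterns other than `±p` are orthogonal to `p`. This decouples the dynamics into pairs
of opposite patterns. -/
theorem sum_mul_signs_dotProduct (f : (Fin 2 → Bool) → ℝ) (p : Fin 2 → Bool) :
    ∑ q, f q * (signs q ⬝ᵥ signs p) = 2 * (f p - f (opposite p)) := by
  have hself : signs p ⬝ᵥ signs p = 2 := by
    simp only [dotProduct, signs, Fin.sum_univ_two, sgn_mul_self]
    norm_num
  rw [Fintype.sum_eq_add p (opposite p), hself, dotProduct_comm (signs (opposite p)),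
    dotProduct_signs_opposite, hself]
  · ring
  · intro h
    have := congrFun h 0
    simp [opposite] at this
  · rintro q ⟨h1, h2⟩
    have h1' : ¬(q 0 = p 0 ∧ q 1 = p 1) := fun h => h1 (funext fun c => by fin_cases c <;> simp [h])
    have h2' : ¬(q 0 = (!p 0) ∧ q 1 = (!p 1)) := fun h =>
      h2 (funext fun c => by fin_cases c <;> simp [h, opposite])
    simp only [dotProduct, signs, Fin.sum_univ_two]
    revert h1' h2'
    cases q 0 <;> cases q 1 <;> cases p 0 <;> cases p 1 <;> simp [sgn]

/-- The pattern that the `j`-th gate reads. -/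
def pattern {i : ℕ} (y : Fin (2 ^ (i + 1)) → Bool) (j : Fin (2 ^ i)) : Fin 2 → Bool :=
  fun c => y (child j c)

/-- The empirical mean of `λ - y` on the examples at which the `j`-th gate reads the pattern `p`. -/
noncomputable def patternGrad {d m i : ℕ} (lam : ℝ) (S : Fin m → Example d)
    (u : (Fin (2 ^ d) → Bool) → Fin (2 ^ (i + 1)) → Bool) (j : Fin (2 ^ i)) (p : Fin 2 → Bool) : ℝ :=
  (1 / (m : ℝ)) * ∑ s, if pattern (u (S s).1) j = p then lam - sgn (S s).2 else 0

section Layer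

variable {d m i k : ℕ} {lam : ℝ} {S : Fin m → Example d}
  {N : (Fin (2 ^ d) → ℝ) → Fin (2 ^ (i + 1)) → ℝ}
  {u : (Fin (2 ^ d) → Bool) → Fin (2 ^ (i + 1)) → Bool}

theorem layerGrad_eq (hN : ∀ x, N (fun a => sgn (x a)) = fun b => sgn (u x b))
    (V : Fin (2 ^ i) → Fin k → ℝ) (W : Fin (2 ^ i) → Fin k → Fin 2 → ℝ) (j : Fin (2 ^ i))
    (l : Fin k) :
    layerGrad lam S N V W j l = ∑ p, ((1 / ((2 ^ i : ℕ) : ℝ)) * patternGrad lam S u j p * V j l *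
      if 0 < W j l ⬝ᵥ signs p ∧ |preact (W j) (V j) (signs p)| < 1 then 1 else 0) • signs p := by
  funext c
  unfold layerGrad patternGrad
  simp only [hN, Finset.sum_apply, Pi.smul_apply, smul_eq_mul]
  simp only [mul_assoc, Finset.mul_sum, Finset.sum_mul]
  rw [Finset.sum_comm]
  refine Finset.sum_congr rfl fun s _ => ?_
  rw [Finset.sum_eq_single (pattern (u (S s).1) j)]
  · have hin : inputs (fun b => sgn (u (S s).1 b)) j = signs (pattern (u (S s).1) j) := rfl
    rw [hin, if_pos rfl, deriv_hardTanh, deriv_relu]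
    -- A saturated gate has derivative 0, so the slope of the loss matters only where `deriv_loss`
    -- applies.
    by_cases hact : |preact (W j) (V j) (signs (pattern (u (S s).1) j))| < 1
    · have havg : |avgPool (block W V fun b => sgn (u (S s).1 b))| < 1 := by
        refine abs_avgPool_lt_one (fun j' => abs_hardTanh_le _) (j := j) ?_
        have : block W V (fun b => sgn (u (S s).1 b)) j =
            preact (W j) (V j) (signs (pattern (u (S s).1) j)) := hardTanh_of_abs_lt hact
        rwa [this]
      rw [deriv_loss lam _ havg, if_pos hact]
      by_cases hpos : 0 < W j l ⬝ᵥ signs (pattern (u (S s).1) j)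
      · rw [if_pos hpos, if_pos ⟨hpos, hact⟩]
        ring
      · rw [if_neg hpos, if_neg (fun h => hpos h.1)]
        ring
    · rw [if_neg hact, if_neg (fun h : 0 < _ ∧ _ => hact h.2)]
      ring
  · intro p _ hp
    rw [if_neg (Ne.symm hp)]
    ring
  · simp

theorem trainLayer_zero {η : ℝ} (V : Fin (2 ^ i) → Fin k → ℝ)
    (W₀ : Fin (2 ^ i) → Fin k → Fin 2 → ℝ) : trainLayer lam η 0 S N V W₀ = W₀ := rfl

theorem trainLayer_succ {η : ℝ} (t : ℕ) (V : Fin (2 ^ i) → Fin k → ℝ)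
    (W₀ : Fin (2 ^ i) → Fin k → Fin 2 → ℝ) :
    trainLayer lam η (t + 1) S N V W₀ = trainLayer lam η t S N V W₀ -
      η • layerGrad lam S N V (trainLayer lam η t S N V W₀) := by
  unfold trainLayer
  rw [Function.iterate_succ_apply']

theorem preact_signs_eq_gateSum (w : Fin k → Fin 2 → ℝ) (v : Fin k → ℝ) (p : Fin 2 → Bool) :
    preact w v (signs p) = gateSum v fun l => w l ⬝ᵥ signs p := rfl

theorem pairDynamics_trainLayer {η : ℝ}
    (hN : ∀ x, N (fun a => sgn (x a)) = fun b => sgn (u x b)) (V : Fin (2 ^ i) → Fin k → ℝ)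
    (W₀ : Fin (2 ^ i) → Fin k → Fin 2 → ℝ) (j : Fin (2 ^ i)) (p : Fin 2 → Bool) :
    PairDynamics (V j) (-(η / ((2 ^ i : ℕ) : ℝ) * patternGrad lam S u j p))
      (-(η / ((2 ^ i : ℕ) : ℝ) * patternGrad lam S u j (opposite p)))
      (fun t l => trainLayer lam η t S N V W₀ j l ⬝ᵥ signs p) := by
  have step : ∀ W l, (W - η • layerGrad lam S N V W) j l ⬝ᵥ signs p = W j l ⬝ᵥ signs p + 2 * V j l *
      ((if 0 < W j l ⬝ᵥ signs p ∧ |gateSum (V j) fun l => W j l ⬝ᵥ signs p| < 1 then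
        -(η / ((2 ^ i : ℕ) : ℝ) * patternGrad lam S u j p) else 0) -
      (if W j l ⬝ᵥ signs p < 0 ∧ |gateSum (V j) (-fun l => W j l ⬝ᵥ signs p)| < 1 then
        -(η / ((2 ^ i : ℕ) : ℝ) * patternGrad lam S u j (opposite p)) else 0)) := by
    intro W l
    simp only [Pi.sub_apply, Pi.smul_apply]
    rw [layerGrad_eq hN, sub_dotProduct, smul_dotProduct, sum_dotProduct]
    simp only [smul_dotProduct, smul_eq_mul]
    rw [sum_mul_signs_dotProduct, preact_signs_eq_gateSum, preact_signs_eq_gateSum]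
    simp only [dotProduct_signs_opposite, Left.neg_pos_iff]
    have e : (-fun l => W j l ⬝ᵥ signs p) = fun l => -(W j l ⬝ᵥ signs p) := rfl
    rw [e]
    split_ifs <;> ring
  intro t l
  exact (congrArg (fun W => W j l ⬝ᵥ signs p) (trainLayer_succ t V W₀)).trans (step _ l)

theorem abs_patternGrad_le (h0 : 0 ≤ lam) (h1 : lam ≤ 1) (j : Fin (2 ^ i)) (p : Fin 2 → Bool) :
    |patternGrad lam S u j p| ≤ 2 := by
  unfold patternGrad
  have hs : |∑ s, if pattern (u (S s).1) j = p then lam - sgn (S s).2 else 0| ≤ m * 2 := by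
    refine (Finset.abs_sum_le_sum_abs _ _).trans ?_
    have : ∑ s : Fin m, (2 : ℝ) = m * 2 := by simp
    rw [← this]
    refine Finset.sum_le_sum fun s _ => ?_
    split_ifs
    · refine (abs_sub _ _).trans ?_
      rw [abs_sgn, abs_of_nonneg h0]
      linarith
    · simp
  rw [abs_mul, abs_of_nonneg (by positivity)]
  rcases Nat.eq_zero_or_pos m with hm | hm
  · subst hm
    simp
  · have hm' : (0 : ℝ) < m := by exact_mod_cast hm
    rw [one_div, inv_mul_le_iff₀ hm']
    exact hs

/-- If the empirical correlations of all patterns that occur have the signs of the targets with a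
margin, and every pattern activates a neuron with the right output weight, the trained gate computes
the targets. -/
theorem neuralGate_trainLayer {η κ : ℝ} {T : ℕ}
    (hN : ∀ x, N (fun a => sgn (x a)) = fun b => sgn (u x b))
    (h0 : 0 ≤ lam) (h1 : lam ≤ 1) (hk : 0 < k) (hη₀ : 0 < η) (hη : η ≤ 1 / (16 * √2 * k))
    (V : Fin (2 ^ i) → Fin k → ℝ) (W₀ : Fin (2 ^ i) → Fin k → Fin 2 → ℝ) (j : Fin (2 ^ i))
    (hV : ∀ l, V j l = 1 ∨ V j l = -1) (hW₀ : ∀ l c, |W₀ j l c| ≤ 1 / (4 * √2 * k))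
    (target : (Fin 2 → Bool) → Bool) (hκ : 0 < κ)
    (hmargin : ∀ x, κ ≤ -(η / ((2 ^ i : ℕ) : ℝ) * (sgn (target (pattern (u x) j)) *
      patternGrad lam S u j (pattern (u x) j))))
    (hcover : ∀ p, ∃ l, V j l = sgn (target p) ∧ 0 < W₀ j l ⬝ᵥ signs p)
    (hT : 1 + 1 / (2 * √2) + 2 * κ < κ * T) (x : Fin (2 ^ d) → Bool) :
    neuralGate (trainLayer lam η T S N V W₀ j) (V j) (signs (pattern (u x) j)) =
      sgn (target (pattern (u x) j)) := by
  set p := pattern (u x) j with hp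
  have hk' : (0 : ℝ) < k := by exact_mod_cast hk
  have hsgn : ∀ b, sgn b = 1 ∨ sgn b = -1 := fun b => by cases b <;> simp [sgn]
  set M : ℝ := 1 / (2 * √2 * k) with hMdef
  have hkM : k * M = 1 / (2 * √2) := by
    rw [hMdef]
    field_simp
  have hsqrt : (1 : ℝ) < √2 := by
    rw [Real.lt_sqrt] <;> norm_num
  have hM : 0 ≤ M := by positivity
  have h2i : (1 : ℝ) ≤ ((2 ^ i : ℕ) : ℝ) := by exact_mod_cast Nat.one_le_two_pow
  -- The gradient means are at most 2, so the bound on the learning rate gives `2η ≤ M/4`.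
  have hβ : ∀ q, |(-(η / ((2 ^ i : ℕ) : ℝ) * patternGrad lam S u j q))| ≤ M / 2 := by
    intro q
    rw [abs_neg, abs_mul, abs_of_nonneg (by positivity)]
    have e1 : η / ((2 ^ i : ℕ) : ℝ) ≤ η := div_le_self hη₀.le h2i
    have e2 := abs_patternGrad_le (S := S) (u := u) h0 h1 j q
    calc _ ≤ η * 2 := mul_le_mul e1 e2 (abs_nonneg _) hη₀.le
      _ ≤ 1 / (16 * √2 * k) * 2 := by linarith
      _ ≤ M / 2 := by
        have e3 : 1 / (16 * √2 * k) = M / 8 := by rw [hMdef]; field_simp; norm_num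
        rw [e3]
        linarith
  have hpd := pairDynamics_trainLayer (lam := lam) (S := S) (η := η) hN V W₀ j p
  have hstart : ∀ l, |trainLayer lam η 0 S N V W₀ j l ⬝ᵥ signs p| ≤ M := by
    intro l
    rw [trainLayer_zero]
    simp only [dotProduct, Fin.sum_univ_two]
    refine (abs_add_le _ _).trans ?_
    rw [abs_mul, abs_mul]
    simp only [signs, abs_sgn, mul_one]
    have e3 : 1 / (4 * √2 * k) = M / 2 := by rw [hMdef]; field_simp; norm_num
    have := hW₀ l 0
    have := hW₀ l 1
    linarith
  have hfin : 1 ≤ sgn (target p) *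
      gateSum (V j) (fun l => trainLayer lam η T S N V W₀ j l ⬝ᵥ signs p) := by
    refine hpd.one_le_gateSum hV hκ hM ?_ (hβ p) (hβ (opposite p)) hstart (hsgn _) ?_ ?_ ?_
      (by rw [hkM]; exact hT)
    · rw [hkM, div_lt_one (by positivity)]
      linarith
    · refine (hmargin x).trans (le_of_eq ?_)
      rw [← hp]
      ring
    · obtain ⟨l, hl, hpos⟩ := hcover p
      exact ⟨l, hl, hpos⟩
    -- There is no margin for a pattern that no input produces, but then its empirical mean is 0 and
    -- it causes no updates.
    · by_cases hocc : ∃ x', pattern (u x') j = opposite p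
      · obtain ⟨x', hx'⟩ := hocc
        refine Or.inr ⟨sgn (target (opposite p)), hsgn _, ?_, ?_⟩
        · refine (hmargin x').trans (le_of_eq ?_)
          rw [hx']
          ring
        · obtain ⟨l, hl, hpos⟩ := hcover (opposite p)
          rw [dotProduct_signs_opposite, Left.neg_pos_iff] at hpos
          exact ⟨l, hl, hpos⟩
      · refine Or.inl ?_
        push Not at hocc
        simp [patternGrad, hocc]
  unfold neuralGate
  rw [preact_signs_eq_gateSum]
  rcases hsgn (target p) with h | h <;> rw [h] at hfin ⊢
  · exact hardTanh_of_one_le (by linarith)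
  · exact hardTanh_of_le_neg_one (by linarith)

end Layer

/-! ## The ideal network and its margins -/

/-- Functions of disjoint groups of independent input bits are uncorrelated. -/
theorem integral_mul_of_dependsOn {d : ℕ} {D : Measure (Example d)} [IsProbabilityMeasure D]
    (hind : iIndepFun (fun (j : Fin (2 ^ d)) (z : Example d) => z.1 j) D)
    {f g : (Fin (2 ^ d) → Bool) → ℝ} {A B : Finset (Fin (2 ^ d))} (hAB : Disjoint A B)
    (hf : ∀ x x', (∀ a ∈ A, x a = x' a) → f x = f x')
    (hg : ∀ x x', (∀ a ∈ B, x a = x' a) → g x = g x') :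
    ∫ z, f z.1 * g z.1 ∂D = (∫ z, f z.1 ∂D) * ∫ z, g z.1 ∂D := by
  have hAB' := hind.indepFun_finset A B hAB fun j => Measurable.of_discrete
  -- `f` factors through the restriction to `A`; the filler value `true` off `A` is immaterial.
  let F : (A → Bool) → ℝ := fun y => f fun a => if h : a ∈ A then y ⟨a, h⟩ else true
  let G : (B → Bool) → ℝ := fun y => g fun a => if h : a ∈ B then y ⟨a, h⟩ else true
  have hF : (fun z : Example d => f z.1) = F ∘ fun z (i : A) => z.1 i := by
    funext z
    exact hf _ _ fun a ha => by simp [ha]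
  have hG : (fun z : Example d => g z.1) = G ∘ fun z (i : B) => z.1 i := by
    funext z
    exact hg _ _ fun a ha => by simp [ha]
  have hFG : IndepFun (fun z : Example d => f z.1) (fun z => g z.1) D := by
    rw [hF, hG]
    exact hAB'.comp Measurable.of_discrete Measurable.of_discrete
  exact hFG.integral_fun_mul_eq_mul_integral Measurable.of_discrete.aestronglyMeasurable
    Measurable.of_discrete.aestronglyMeasurable

section Ideal

variable {d : ℕ} (C : TreeCircuit d) (D : Measure (Example d))

/-- The output of the ideally trained gate of a node, as a function of the value of this node in the
circuit: irrelevant nodes give the constant `-1`, relevant ones the value up to the sign of its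
correlation with the label. -/
noncomputable def idealBit {i : ℕ} (hi : i ≤ d) (j : Fin (2 ^ i)) (b : Bool) : Bool :=
  if i = d then b
  else if C.influence hi j = 0 then false
  else if 0 < correlation C D hi j then b else !b

/-- The ideally trained network. -/
noncomputable def ideal {i : ℕ} (hi : i ≤ d) (x : Fin (2 ^ d) → Bool) (j : Fin (2 ^ i)) : Bool :=
  idealBit C D hi j (C.val hi x j)

/-- The mean of the label after the value of a node has been overwritten. -/
noncomputable def forcedMean {i : ℕ} (hi : i ≤ d) (j : Fin (2 ^ i)) (b : Bool) : ℝ :=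
  ∫ z, sgn (C.top hi (Function.update (C.val hi z.1) j b)) ∂D

/-- The probability that the function `f` of the input bits has the value `b`. -/
noncomputable def probEq {α : Type*} [DecidableEq α] (f : (Fin (2 ^ d) → Bool) → α) (b : α) : ℝ :=
  ∫ z, (if f z.1 = b then 1 else 0) ∂D

variable {C D}

theorem ideal_depth (x : Fin (2 ^ d) → Bool) : ideal C D le_rfl x = x := by
  funext j
  simp [ideal, idealBit, C.val_depth]

theorem idealBit_injective {i : ℕ} {hi : i ≤ d} {j : Fin (2 ^ i)} (h : C.influence hi j ≠ 0) :
    Function.Injective (idealBit C D hi j) := by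
  intro a b hab
  unfold idealBit at hab
  rw [if_neg h] at hab
  split_ifs at hab
  · exact hab
  · exact hab
  · simpa using hab

theorem probEq_nonneg {α : Type*} [DecidableEq α] (f : (Fin (2 ^ d) → Bool) → α) (b : α) :
    0 ≤ probEq D f b := by
  refine integral_nonneg fun z => ?_
  dsimp only
  split_ifs <;> norm_num

theorem labelMean_eq (hsep : SeparableBy C D) : labelMean D = ∫ z, sgn (C.eval z.1) ∂D :=
  integral_congr_ae (hsep.mono fun z hz => by simp only [hz])

theorem correlation_eq (hsep : SeparableBy C D) {i : ℕ} (hi : i ≤ d) (j : Fin (2 ^ i)) :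
    correlation C D hi j = ∫ z, sgn (C.val hi z.1 j) * sgn (C.eval z.1) ∂D :=
  integral_congr_ae (hsep.mono fun z hz => by simp only [hz]; rfl)

theorem ideal_congr {i : ℕ} (hi : i ≤ d) {x x' : Fin (2 ^ d) → Bool} (j : Fin (2 ^ i))
    (h : ∀ a ∈ TreeCircuit.leaves d j, x a = x' a) : ideal C D hi x j = ideal C D hi x' j := by
  unfold ideal
  rw [C.val_congr hi j h]

theorem forcedMean_of_influence_eq_zero (hsep : SeparableBy C D) {i : ℕ} {hi : i ≤ d}
    {j : Fin (2 ^ i)} (h : C.influence hi j = 0) (b : Bool) :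
    forcedMean C D hi j b = labelMean D := by
  have h' : ¬C.Relevant hi j := fun hr => (C.influence_ne_zero_iff hi j).2 hr h
  rw [labelMean_eq hsep]
  unfold forcedMean
  congr 1
  funext z
  rw [C.top_update_of_not_relevant h', C.top_val]

variable [IsProbabilityMeasure D]

theorem probEq_le_one {α : Type*} [DecidableEq α] (f : (Fin (2 ^ d) → Bool) → α) (b : α) :
    probEq D f b ≤ 1 := by
  have : ∫ _z : Example d, (1 : ℝ) ∂D = 1 := by simp
  rw [← this]
  refine integral_mono .of_finite .of_finite fun z => ?_
  dsimp only
  split_ifs <;> norm_num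

theorem probEq_mono {α β : Type*} [DecidableEq α] [DecidableEq β]
    {f : (Fin (2 ^ d) → Bool) → α} {g : (Fin (2 ^ d) → Bool) → β} {a : α} {b : β}
    (h : ∀ x, f x = a → g x = b) : probEq D f a ≤ probEq D g b := by
  refine integral_mono .of_finite .of_finite fun z => ?_
  dsimp only
  split_ifs with h1 h2 h2
  · rfl
  · exact absurd (h _ h1) h2
  · norm_num
  · rfl

theorem probEq_true_add_false (f : (Fin (2 ^ d) → Bool) → Bool) :
    probEq D f true + probEq D f false = 1 := by
  unfold probEq
  rw [← integral_add .of_finite .of_finite]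
  have : ∀ z : Example d, ((if f z.1 = true then (1 : ℝ) else 0) + if f z.1 = false then 1 else 0) = 1 := by
    intro z
    cases f z.1 <;> simp
  simp [this]

theorem abs_forcedMean_le {i : ℕ} (hi : i ≤ d) (j : Fin (2 ^ i)) (b : Bool) :
    |forcedMean C D hi j b| ≤ 1 := by
  refine (abs_integral_le_integral_abs).trans (le_of_eq ?_)
  simp [abs_sgn]

theorem eval_eq_top_update {i : ℕ} (hi : i ≤ d) {j : Fin (2 ^ i)} {x : Fin (2 ^ d) → Bool} {b : Bool}
    (h : C.val hi x j = b) : C.eval x = C.top hi (Function.update (C.val hi x) j b) := by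
  rw [← h, Function.update_eq_self, C.top_val]

/-- A function of the leaves below a node, as a weight, is uncorrelated with the output after
overwriting the value of this node. -/
theorem integral_indicator_mul_forced {α : Type*} [DecidableEq α]
    (hind : iIndepFun (fun (j : Fin (2 ^ d)) (z : Example d) => z.1 j) D)
    {i : ℕ} (hi : i ≤ d) (j : Fin (2 ^ i)) {f : (Fin (2 ^ d) → Bool) → α} (a : α) (b : Bool) (r : ℝ)
    (hf : ∀ x x', (∀ l ∈ TreeCircuit.leaves d j, x l = x' l) → f x = f x') :
    ∫ z, (if f z.1 = a then 1 else 0) *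
      (sgn (C.top hi (Function.update (C.val hi z.1) j b)) - r) ∂D =
        probEq D f a * (forcedMean C D hi j b - r) := by
  rw [integral_mul_of_dependsOn hind (A := TreeCircuit.leaves d j)
    (B := (TreeCircuit.leaves d j)ᶜ) (f := fun x => if f x = a then 1 else 0)
    (g := fun x => sgn (C.top hi (Function.update (C.val hi x) j b)) - r) disjoint_compl_right
    (fun x x' h => by simp only [hf x x' h])
    (fun x x' h => by
      rw [C.top_update_val_congr hi j b fun l hl => h l (by simpa using hl)])]
  rw [integral_sub .of_finite .of_finite]
  simp [probEq, forcedMean]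

theorem integral_val_mul_label (hind : iIndepFun (fun (j : Fin (2 ^ d)) (z : Example d) => z.1 j) D)
    {i : ℕ} (hi : i ≤ d) (j : Fin (2 ^ i)) (b : Bool) :
    ∫ z, (if C.val hi z.1 j = b then 1 else 0) * sgn (C.eval z.1) ∂D =
      probEq D (fun x => C.val hi x j) b * forcedMean C D hi j b := by
  have := integral_indicator_mul_forced (C := C) hind hi j (f := fun x => C.val hi x j) b b 0
    (fun x x' h => C.val_congr hi j h)
  simp only [sub_zero] at this
  rw [← this]
  congr 1
  funext z
  split_ifs with h
  · rw [eval_eq_top_update hi h]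
  · simp

/-- Split by the value of the node, which is independent of the output with that value overwritten.
With `correlation_eq_sub` this turns local correlation into a statement about the two forced means.
-/
theorem labelMean_eq_add (hind : iIndepFun (fun (j : Fin (2 ^ d)) (z : Example d) => z.1 j) D)
    (hsep : SeparableBy C D) {i : ℕ} (hi : i ≤ d) (j : Fin (2 ^ i)) :
    labelMean D = probEq D (fun x => C.val hi x j) true * forcedMean C D hi j true +
      probEq D (fun x => C.val hi x j) false * forcedMean C D hi j false := by
  rw [labelMean_eq hsep, ← integral_val_mul_label hind, ← integral_val_mul_label hind,
    ← integral_add .of_finite .of_finite]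
  congr 1
  funext z
  cases C.val hi z.1 j <;> simp

theorem correlation_eq_sub (hind : iIndepFun (fun (j : Fin (2 ^ d)) (z : Example d) => z.1 j) D)
    (hsep : SeparableBy C D) {i : ℕ} (hi : i ≤ d) (j : Fin (2 ^ i)) :
    correlation C D hi j = probEq D (fun x => C.val hi x j) true * forcedMean C D hi j true -
      probEq D (fun x => C.val hi x j) false * forcedMean C D hi j false := by
  rw [correlation_eq hsep, ← integral_val_mul_label hind, ← integral_val_mul_label hind,
    ← integral_sub .of_finite .of_finite]
  congr 1
  funext z
  cases C.val hi z.1 j <;> simp [sgn_true, sgn_false]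

/-! ### Local correlation and the resulting margins -/

theorem exists_influence_ne_zero (hd : 1 ≤ d) (hC : ∃ x x', C.eval x ≠ C.eval x') :
    ∃ j, C.influence hd j ≠ 0 := by
  by_contra! hcon
  obtain ⟨x, x', hx⟩ := hC
  apply hx
  have hd' : 0 < d := hd
  rw [← C.val_zero x 0, ← C.val_zero x' 0, C.val_succ hd', C.val_succ hd']
  refine C.gate_congr_of_sensitive hd' 0 (x₀ := x) ?_ fun c hc => ?_
  · rw [C.top_zero, C.top_zero]
    simp
  · exact absurd (hcon _) ((C.influence_ne_zero_iff _ _).2 hc)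

theorem abs_correlation_le {i : ℕ} (hi : i ≤ d) (j : Fin (2 ^ i)) : |correlation C D hi j| ≤ 1 := by
  refine (abs_integral_le_integral_abs).trans (le_of_eq ?_)
  simp [abs_sgn, abs_mul]

/-- A nonconstant circuit has a relevant child of the root, and correlations are at most 1. This
extends local correlation to the root and yields `λ ≤ 1`. -/
theorem labelMean_add_lt_one {Δ : ℝ} (hd : 1 ≤ d) (hC : ∃ x x', C.eval x ≠ C.eval x')
    (hlca : LCA C D Δ) : labelMean D + Δ < 1 := by
  obtain ⟨j, hj⟩ := exists_influence_ne_zero hd hC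
  exact (hlca 1 le_rfl hd j hj).trans_le (abs_correlation_le _ _)

theorem correlation_root (hsep : SeparableBy C D) (j : Fin (2 ^ 0)) :
    correlation C D (Nat.zero_le d) j = 1 := by
  rw [correlation_eq hsep]
  simp [C.val_zero, sgn_mul_self]

/-- The local correlation assumption extends to the root. -/
theorem labelMean_add_lt_abs_correlation {Δ : ℝ} (hd : 1 ≤ d)
    (hC : ∃ x x', C.eval x ≠ C.eval x') (hsep : SeparableBy C D) (hlca : LCA C D Δ)
    {i : ℕ} (hi : i ≤ d) (j : Fin (2 ^ i)) (h : C.influence hi j ≠ 0) :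
    labelMean D + Δ < |correlation C D hi j| := by
  rcases Nat.eq_zero_or_pos i with rfl | hpos
  · rw [correlation_root hsep, abs_one]
    exact labelMean_add_lt_one hd hC hlca
  · exact hlca i hpos hi j h

/-- Adding and subtracting the hypotheses gives `P e > μ + Δ/2` and `Q f < -Δ/2`; all four factors
are at most 1 in absolute value, so each inherits the bound of its product. -/
theorem mul_separation {P Q e f μ Δ : ℝ} (hP : 0 ≤ P) (hP1 : P ≤ 1) (hQ : 0 ≤ Q) (hQ1 : Q ≤ 1)
    (he : |e| ≤ 1) (hf : |f| ≤ 1) (hμ : 0 ≤ μ) (hΔ : 0 < Δ) (hsum : μ = P * e + Q * f)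
    (hdiff : μ + Δ < P * e - Q * f) :
    Δ / 2 ≤ P ∧ Δ / 2 ≤ Q ∧ μ + Δ / 2 ≤ e ∧ f ≤ -(Δ / 2) := by
  have h1 : μ + Δ / 2 < P * e := by linarith
  have h2 : Q * f < -(Δ / 2) := by linarith
  have e1 := abs_le.1 he
  have f1 := abs_le.1 hf
  refine ⟨by nlinarith, by nlinarith, ?_, ?_⟩
  · have : 0 < e := by
      by_contra hn
      nlinarith
    nlinarith
  · have : f < 0 := by
      by_contra hn
      nlinarith
    nlinarith

/-- The consequences of local correlation at a relevant node. -/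
theorem relevant_margin {Δ : ℝ} (hd : 1 ≤ d) (hΔ : 0 < Δ)
    (hind : iIndepFun (fun (j : Fin (2 ^ d)) (z : Example d) => z.1 j) D)
    (hC : ∃ x x', C.eval x ≠ C.eval x') (hsep : SeparableBy C D) (hmean : 0 ≤ labelMean D)
    (hlca : LCA C D Δ) {i : ℕ} (hi : i ≤ d) (j : Fin (2 ^ i)) (h : C.influence hi j ≠ 0) (b : Bool) :
    Δ / 2 ≤ probEq D (fun x => C.val hi x j) b ∧
      Δ / 4 ≤ (if 0 < correlation C D hi j then sgn b else -sgn b) *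
        (forcedMean C D hi j b - (labelMean D + Δ / 4)) := by
  have h1 := labelMean_add_lt_abs_correlation hd hC hsep hlca hi j h
  have h2 := labelMean_eq_add hind hsep hi j
  have h3 := correlation_eq_sub hind hsep hi j
  have hP := fun b => probEq_nonneg (D := D) (fun x => C.val hi x j) b
  have hP1 := fun b => probEq_le_one (D := D) (fun x => C.val hi x j) b
  have he := fun b => abs_forcedMean_le (C := C) (D := D) hi j b
  split_ifs with hpos
  · rw [abs_of_pos hpos, h3] at h1
    obtain ⟨r1, r2, r3, r4⟩ := mul_separation (hP true) (hP1 true) (hP false) (hP1 false) (he true)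
      (he false) hmean hΔ h2 h1
    cases b
    · exact ⟨r2, by rw [sgn_false]; linarith⟩
    · exact ⟨r1, by rw [sgn_true]; linarith⟩
  · rw [abs_of_nonpos (not_lt.1 hpos), h3] at h1
    obtain ⟨r1, r2, r3, r4⟩ := mul_separation (hP false) (hP1 false) (hP true) (hP1 true) (he false)
      (he true) hmean hΔ (h2.trans (add_comm _ _)) (by linarith)
    cases b
    · exact ⟨r1, by rw [sgn_false]; linarith⟩
    · exact ⟨r2, by rw [sgn_true]; linarith⟩

/-- Relevance only provides some assignment of the level, perhaps one that no input attains. An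
attained one exists because otherwise both forced means would coincide, although `relevant_margin`
puts them on opposite sides of `λ`. -/
theorem exists_sensitive {Δ : ℝ} (hd : 1 ≤ d) (hΔ : 0 < Δ)
    (hind : iIndepFun (fun (j : Fin (2 ^ d)) (z : Example d) => z.1 j) D)
    (hC : ∃ x x', C.eval x ≠ C.eval x') (hsep : SeparableBy C D) (hmean : 0 ≤ labelMean D)
    (hlca : LCA C D Δ) {i : ℕ} (hi : i ≤ d) (j : Fin (2 ^ i)) (h : C.influence hi j ≠ 0) :
    ∃ x, C.top hi (Function.update (C.val hi x) j true) ≠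
      C.top hi (Function.update (C.val hi x) j false) := by
  by_contra! hcon
  have heq : forcedMean C D hi j true = forcedMean C D hi j false := by
    unfold forcedMean
    simp only [hcon]
  have h1 := (relevant_margin hd hΔ hind hC hsep hmean hlca hi j h true).2
  have h2 := (relevant_margin hd hΔ hind hC hsep hmean hlca hi j h false).2
  rw [heq] at h1
  rw [sgn_true] at h1
  rw [sgn_false] at h2
  split_ifs at h1 h2 <;> linarith

/-- The inputs of an ideally trained gate determine the value of a relevant node. -/
theorem val_eq_of_pattern_eq {Δ : ℝ} (hd : 1 ≤ d) (hΔ : 0 < Δ)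
    (hind : iIndepFun (fun (j : Fin (2 ^ d)) (z : Example d) => z.1 j) D)
    (hC : ∃ x x', C.eval x ≠ C.eval x') (hsep : SeparableBy C D) (hmean : 0 ≤ labelMean D)
    (hlca : LCA C D Δ) {i : ℕ} (hi : i < d) (j : Fin (2 ^ i)) (h : C.influence hi.le j ≠ 0)
    {x x' : Fin (2 ^ d) → Bool}
    (hp : pattern (ideal C D (Nat.succ_le_of_lt hi) x) j =
      pattern (ideal C D (Nat.succ_le_of_lt hi) x') j) :
    C.val hi.le x j = C.val hi.le x' j := by
  obtain ⟨x₀, hx₀⟩ := exists_sensitive hd hΔ hind hC hsep hmean hlca hi.le j h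
  rw [C.val_succ hi, C.val_succ hi]
  refine C.gate_congr_of_sensitive hi j hx₀ fun c hc => ?_
  exact idealBit_injective ((C.influence_ne_zero_iff _ _).2 hc) (congrFun hp c)

theorem probEq_depth {Δ : ℝ} (hprod : NondegenerateProduct D Δ) (j : Fin (2 ^ d)) (b : Bool) :
    Δ / 2 ≤ probEq D (fun x => C.val le_rfl x j) b := by
  have h1 : probEq D (fun x => C.val le_rfl x j) true = D.real {z | z.1 j = true} := by
    unfold probEq
    simp only [C.val_depth]
    rw [← integral_indicator_one (MeasurableSet.of_discrete)]
    simp [Set.indicator_apply]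
  have h2 := probEq_true_add_false (D := D) fun x => C.val le_rfl x j
  have h3 := hprod.2 j
  have h4 := h3.1
  have h5 := h3.2
  have : 0 ≤ D.real {z | z.1 j = true} := measureReal_nonneg
  have : D.real {z | z.1 j = true} ≤ 1 := measureReal_le_one
  cases b <;> linarith

theorem le_probEq_ideal {Δ : ℝ} (hd : 1 ≤ d) (hΔ : 0 < Δ) (hΔ' : Δ < 1 / 2)
    (hprod : NondegenerateProduct D Δ)
    (hC : ∃ x x', C.eval x ≠ C.eval x') (hsep : SeparableBy C D) (hmean : 0 ≤ labelMean D)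
    (hlca : LCA C D Δ) {i : ℕ} (hi : i ≤ d) (j : Fin (2 ^ i)) (x : Fin (2 ^ d) → Bool) :
    Δ / 2 ≤ probEq D (fun x => ideal C D hi x j) (ideal C D hi x j) := by
  have hmono : probEq D (fun x => C.val hi x j) (C.val hi x j) ≤
      probEq D (fun x => ideal C D hi x j) (ideal C D hi x j) :=
    probEq_mono fun x' h => by simp only [ideal, h]
  rcases hi.eq_or_lt with rfl | hlt
  · exact (probEq_depth hprod j _).trans hmono
  · by_cases h0 : C.influence hi j = 0
    · have : ∀ x', ideal C D hi x' j = ideal C D hi x j := fun x' => by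
        simp [ideal, idealBit, h0, hlt.ne]
      simp only [probEq, this, if_true, integral_const, probReal_univ, smul_eq_mul, mul_one]
      linarith
    · exact (relevant_margin hd hΔ hprod.1 hC hsep hmean hlca hi j h0 _).1.trans hmono

theorem pattern_eq_iff {i : ℕ} {y : Fin (2 ^ (i + 1)) → Bool} {j : Fin (2 ^ i)} {p : Fin 2 → Bool} :
    pattern y j = p ↔ y (child j 0) = p 0 ∧ y (child j 1) = p 1 := by
  rw [funext_iff, Fin.forall_fin_two]
  rfl

/-- The two children sit over disjoint sets of leaves, so the probability is a product of two
factors, each at least `Δ/2`. Only patterns attained by some `x` are covered. -/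
theorem le_probEq_pattern {Δ : ℝ} (hd : 1 ≤ d) (hΔ : 0 < Δ) (hΔ' : Δ < 1 / 2)
    (hprod : NondegenerateProduct D Δ)
    (hC : ∃ x x', C.eval x ≠ C.eval x') (hsep : SeparableBy C D) (hmean : 0 ≤ labelMean D)
    (hlca : LCA C D Δ) {i : ℕ} (hi : i < d) (j : Fin (2 ^ i)) (x : Fin (2 ^ d) → Bool) :
    Δ ^ 2 / 4 ≤ probEq D (fun x => pattern (ideal C D (Nat.succ_le_of_lt hi) x) j)
      (pattern (ideal C D (Nat.succ_le_of_lt hi) x) j) := by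
  set U := ideal C D (Nat.succ_le_of_lt hi) with hU
  have h01 : child j 0 ≠ child j 1 := fun h => by simpa using child_injective j h
  have hmul : probEq D (fun x => pattern (U x) j) (pattern (U x) j) =
      probEq D (fun x => U x (child j 0)) (U x (child j 0)) *
        probEq D (fun x => U x (child j 1)) (U x (child j 1)) := by
    unfold probEq
    rw [← integral_mul_of_dependsOn hprod.1 (TreeCircuit.disjoint_leaves h01)
      (f := fun z => if U z (child j 0) = U x (child j 0) then 1 else 0)
      (g := fun z => if U z (child j 1) = U x (child j 1) then 1 else 0)
      (fun x x' h => by rw [hU, ideal_congr _ _ h]) (fun x x' h => by rw [hU, ideal_congr _ _ h])]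
    congr 1
    funext z
    simp only [pattern_eq_iff, ite_and, ite_mul, one_mul, zero_mul]
    rfl
  rw [hmul]
  have h0 := le_probEq_ideal hd hΔ hΔ' hprod hC hsep hmean hlca (Nat.succ_le_of_lt hi) (child j 0) x
  have h1 := le_probEq_ideal hd hΔ hΔ' hprod hC hsep hmean hlca (Nat.succ_le_of_lt hi) (child j 1) x
  nlinarith

/-- The population correlation of a pattern with the label has the sign of the ideal output. -/
theorem pattern_margin {Δ : ℝ} (hd : 1 ≤ d) (hΔ : 0 < Δ) (hΔ' : Δ < 1 / 2)
    (hprod : NondegenerateProduct D Δ)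
    (hC : ∃ x x', C.eval x ≠ C.eval x') (hsep : SeparableBy C D) (hmean : 0 ≤ labelMean D)
    (hlca : LCA C D Δ) {i : ℕ} (hi : i < d) (j : Fin (2 ^ i)) (x : Fin (2 ^ d) → Bool) :
    Δ ^ 3 / 16 ≤ sgn (ideal C D hi.le x j) *
      ∫ z, (if pattern (ideal C D (Nat.succ_le_of_lt hi) z.1) j =
        pattern (ideal C D (Nat.succ_le_of_lt hi) x) j
          then sgn z.2 - (labelMean D + Δ / 4) else 0) ∂D := by
  set U := ideal C D (Nat.succ_le_of_lt hi) with hU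
  set b := C.val hi.le x j with hb
  have hpat : ∀ x x', (∀ l ∈ TreeCircuit.leaves d j, x l = x' l) → pattern (U x) j = pattern (U x') j :=
    fun x x' h => funext fun c =>
      ideal_congr _ _ fun a ha => h a (TreeCircuit.leaves_child_subset hi j c ha)
  have hint : ∫ z, (if pattern (U z.1) j = pattern (U x) j
      then sgn z.2 - (labelMean D + Δ / 4) else 0) ∂D =
      probEq D (fun x => pattern (U x) j) (pattern (U x) j) *
        (forcedMean C D hi.le j b - (labelMean D + Δ / 4)) := by
    -- On the event that the pattern is read, a relevant node has the value `b` and an irrelevant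
    -- one may be overwritten freely, so the label is the output forced by `b`.
    rw [← integral_indicator_mul_forced hprod.1 hi.le j _ b _ hpat]
    refine integral_congr_ae (hsep.mono fun z hz => ?_)
    dsimp only
    split_ifs with h
    · rw [one_mul, hz]
      by_cases h0 : C.influence hi.le j = 0
      · have h' : ¬C.Relevant hi.le j := fun hr => (C.influence_ne_zero_iff hi.le j).2 hr h0
        rw [C.top_update_of_not_relevant h', C.top_val]
      · rw [eval_eq_top_update hi.le
          (val_eq_of_pattern_eq hd hΔ hprod.1 hC hsep hmean hlca hi j h0 h)]
    · simp
  rw [hint, mul_left_comm]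
  have h1 := le_probEq_pattern hd hΔ hΔ' hprod hC hsep hmean hlca hi j x
  have h2 : Δ / 4 ≤ sgn (ideal C D hi.le x j) *
      (forcedMean C D hi.le j b - (labelMean D + Δ / 4)) := by
    by_cases h0 : C.influence hi.le j = 0
    · rw [forcedMean_of_influence_eq_zero hsep h0]
      have : ideal C D hi.le x j = false := by simp [ideal, idealBit, h0, hi.ne]
      rw [this, sgn_false]
      linarith
    · have h3 := (relevant_margin hd hΔ hprod.1 hC hsep hmean hlca hi.le j h0 b).2
      have : sgn (ideal C D hi.le x j) =
          if 0 < correlation C D hi.le j then sgn b else -sgn b := by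
        unfold ideal idealBit
        rw [if_neg hi.ne, if_neg h0, ← hb]
        split_ifs
        · rfl
        · exact sgn_not b
      rwa [this]
  have h3 : Δ ^ 3 / 16 = Δ ^ 2 / 4 * (Δ / 4) := by ring
  rw [h3]
  exact mul_le_mul h1 h2 (by positivity) (probEq_nonneg _ _)

theorem ideal_root (hd : 1 ≤ d) (hsep : SeparableBy C D) (x : Fin (2 ^ d) → Bool) (j : Fin (2 ^ 0)) :
    ideal C D (Nat.zero_le d) x j = C.eval x := by
  have hinf : C.influence (Nat.zero_le d) j ≠ 0 := by
    rw [C.influence_ne_zero_iff]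
    refine ⟨fun _ => true, ?_⟩
    have : j = 0 := Subsingleton.elim (α := Fin 1) _ _
    rw [C.top_zero, C.top_zero, this]
    simp
  unfold ideal idealBit
  rw [if_neg (by omega), if_neg hinf, correlation_root hsep, if_pos one_pos, C.val_zero]

end Ideal

/-! ## Concentration of sample means -/

/-- Hoeffding's inequality for the mean of a sample. -/
theorem measureReal_sampleMean_le {α : Type*} [MeasurableSpace α] (D : Measure α)
    [IsProbabilityMeasure D] {m : ℕ} (hm : 0 < m) {f : α → ℝ} (hf : Measurable f) {a : ℝ}
    (hfa : ∀ z, f z ∈ Set.Icc a (a + 2)) {ε : ℝ} (hε : 0 ≤ ε) :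
    (Measure.pi fun _ : Fin m => D).real
      {S | (1 / (m : ℝ)) * ∑ s, f (S s) ≤ ∫ z, f z ∂D - ε} ≤ Real.exp (-(m * ε ^ 2 / 2)) := by
  have hm' : (0 : ℝ) < m := by exact_mod_cast hm
  set Q := Measure.pi fun _ : Fin m => D
  have hint : ∀ s : Fin m, ∫ S, -f (S s) ∂Q = -∫ z, f z ∂D := by
    intro s
    rw [integral_neg]
    congr 1
    exact integral_comp_eval (μ := fun _ : Fin m => D) (i := s) hf.aestronglyMeasurable
  have hind : iIndepFun (fun (s : Fin m) (S : Fin m → α) => -f (S s) - -∫ z, f z ∂D) Q :=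
    iIndepFun_pi (μ := fun _ : Fin m => D) (X := fun _ z => -f z - -∫ z, f z ∂D)
      fun _ => (hf.neg.sub_const _).aemeasurable
  have hsub : ∀ s ∈ Finset.univ, HasSubgaussianMGF (fun S : Fin m → α => -f (S s) - -∫ z, f z ∂D)
      1 Q := by
    intro s _
    -- The range has length 2, hence the sub-Gaussian parameter is `(2/2)² = 1`; negation turns the
    -- lower tail into an upper one.
    have h := hasSubgaussianMGF_of_mem_Icc (μ := Q) (X := fun S : Fin m → α => -f (S s))
      (a := -(a + 2)) (b := -a) (hf.comp (measurable_pi_apply s)).neg.aemeasurable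
      (.of_forall fun S => by
        have := hfa (S s)
        exact ⟨neg_le_neg this.2, neg_le_neg this.1⟩)
    rw [hint] at h
    convert h using 1
    have : -a - -(a + 2) = 2 := by ring
    rw [this]
    ext
    simp
  have h := HasSubgaussianMGF.measure_sum_ge_le_of_iIndepFun hind hsub (ε := m * ε) (by positivity)
  have hset : {S : Fin m → α | (1 / (m : ℝ)) * ∑ s, f (S s) ≤ ∫ z, f z ∂D - ε} =
      {S | m * ε ≤ ∑ s, (-f (S s) - -∫ z, f z ∂D)} := by
    ext S
    simp only [Set.mem_ofPred_eq, Finset.sum_sub_distrib, Finset.sum_neg_distrib, Finset.sum_const,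
      Finset.card_univ, Fintype.card_fin, nsmul_eq_mul]
    rw [one_div, inv_mul_le_iff₀ hm']
    constructor <;> intro h <;> linarith
  rw [hset]
  refine h.trans (le_of_eq ?_)
  congr 1
  simp only [Finset.sum_const, Finset.card_univ, Fintype.card_fin, nsmul_eq_mul,
    mul_one, NNReal.coe_natCast]
  field_simp

/-! ## Coverage by the initialization -/

section Cover

/-- Independence of the weights of distinct neurons, for events about single neurons. -/
theorem measureReal_forall_neuron {ι : Type*} [Fintype ι] {k : ℕ} {E F : Type*} [MeasurableSpace E]
    [MeasurableSpace F] (μ : ι → Measure E) [∀ ν, IsProbabilityMeasure (μ ν)] (U : Measure F)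
    [IsProbabilityMeasure U] {e : Fin k → ι} (he : Function.Injective e) (B : Fin k → Set (E × F)) :
    ((Measure.pi μ).prod (Measure.pi fun _ => U)).real
      {ω | ∀ l, (ω.1 (e l), ω.2 (e l)) ∈ B l} = ∏ l, ((μ (e l)).prod U).real (B l) := by
  -- Regrouping the two weights of each neuron makes the law a product over neurons; those outside
  -- the range of `e` contribute the factor 1.
  have hmp := measurePreserving_arrowProdEquivProdArrow E F ι μ fun _ => U
  rw [measureReal_def, ← hmp.measure_preimage_equiv]
  have hset : (MeasurableEquiv.arrowProdEquivProdArrow E F ι) ⁻¹'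
      {ω | ∀ l, (ω.1 (e l), ω.2 (e l)) ∈ B l} =
      Set.univ.pi fun ν => {z : E × F | ∀ l, e l = ν → z ∈ B l} := by
    ext ω
    simp only [Set.mem_preimage, Set.mem_ofPred_eq, Set.mem_pi, Set.mem_univ, true_implies]
    constructor
    · rintro h _ l rfl
      exact h l
    · exact fun h l => h _ l rfl
  rw [hset, Measure.pi_pi, ENNReal.toReal_prod]
  symm
  refine Fintype.prod_of_injective e he _ _ ?_ ?_
  · intro ν hν
    have : {z : E × F | ∀ l, e l = ν → z ∈ B l} = Set.univ :=
      Set.eq_univ_of_forall fun z l hl => absurd ⟨l, hl⟩ hν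
    rw [this]
    simp
  · intro l
    have : {z : E × F | ∀ l', e l' = e l → z ∈ B l'} = B l := by
      ext z
      exact ⟨fun h => h l rfl, fun h l' hl' => he hl' ▸ h⟩
    rw [this]
    rfl

theorem uniformOn_bool_singleton (t : Bool) :
    (uniformOn (Set.univ : Set Bool)).real {t} = 1 / 2 := by
  rw [measureReal_def, uniformOn_univ]
  simp

instance uniformOn_bool_isProbabilityMeasure :
    IsProbabilityMeasure (uniformOn (Set.univ : Set Bool)) :=
  isProbabilityMeasure_uniformOn Set.finite_univ Set.univ_nonempty

/-- The initial weights with which a hidden neuron has the output weight `t` and is activated by the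
pattern `p`. -/
def activeWith (p : Fin 2 → Bool) (t : Bool) : Set ((Fin 2 → ℝ) × Bool) :=
  {w | 0 < w ⬝ᵥ signs p} ×ˢ {t}

theorem measurableSet_activeWith (p : Fin 2 → Bool) (t : Bool) :
    MeasurableSet (activeWith p t) := by
  refine MeasurableSet.prod ?_ (MeasurableSet.singleton t)
  have : Measurable fun w : Fin 2 → ℝ => w ⬝ᵥ signs p := by
    unfold dotProduct
    fun_prop
  exact measurableSet_lt measurable_const this

theorem measureReal_activeWith {r : ℝ} {μ : Measure (Fin 2 → ℝ)} (h : IsInitLaw r μ)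
    (p : Fin 2 → Bool) (t : Bool) :
    (μ.prod (uniformOn (Set.univ : Set Bool))).real (activeWith p t) = 1 / 4 := by
  have := h.isProbabilityMeasure
  have hb : μ.real {w | 0 < w ⬝ᵥ signs p} = 1 / 2 := by
    rw [measureReal_def]
    have := h.balanced p
    unfold signs
    rw [this]
    simp
  unfold activeWith
  rw [measureReal_prod_prod, hb, uniformOn_bool_singleton]
  norm_num

theorem disjoint_activeWith_opposite (p : Fin 2 → Bool) (t t' : Bool) :
    Disjoint (activeWith p t) (activeWith (opposite p) t') := by
  rw [Set.disjoint_left]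
  rintro w ⟨h1, _⟩ ⟨h2, _⟩
  rw [Set.mem_ofPred_eq] at h1 h2
  rw [dotProduct_signs_opposite] at h2
  linarith

variable {ι : Type*} {k : ℕ} {r : ℝ} {μ : ι → Measure (Fin 2 → ℝ)}

/-- The initializations for which no neuron of a gate has the output weight `t` and is activated by
the pattern `p`. -/
def uncovered (e : Fin k → ι) (p : Fin 2 → Bool) (t : Bool) :
    Set ((ι → Fin 2 → ℝ) × (ι → Bool)) :=
  {ω | ∀ l, (ω.1 (e l), ω.2 (e l)) ∈ (activeWith p t)ᶜ}

theorem measurableSet_uncovered (e : Fin k → ι) (p : Fin 2 → Bool) (t : Bool) :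
    MeasurableSet (uncovered e p t) := by
  unfold uncovered
  rw [Set.ofPred_forall]
  refine MeasurableSet.iInter fun l => ?_
  exact ((measurable_pi_apply (e l)).comp measurable_fst).prodMk
    ((measurable_pi_apply (e l)).comp measurable_snd) (measurableSet_activeWith p t).compl

variable [Fintype ι]

theorem measureReal_uncovered (hμ : ∀ ν, IsInitLaw r (μ ν)) {e : Fin k → ι}
    (he : Function.Injective e) (p : Fin 2 → Bool) (t : Bool) :
    ((Measure.pi μ).prod (Measure.pi fun _ => uniformOn (Set.univ : Set Bool))).real
      (uncovered e p t) = (3 / 4) ^ k := by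
  have := fun ν => (hμ ν).isProbabilityMeasure
  unfold uncovered
  rw [measureReal_forall_neuron μ _ he]
  have : ∀ l, ((μ (e l)).prod (uniformOn (Set.univ : Set Bool))).real (activeWith p t)ᶜ = 3 / 4 := by
    intro l
    rw [probReal_compl_eq_one_sub (measurableSet_activeWith p t), measureReal_activeWith (hμ _)]
    norm_num
  rw [Finset.prod_congr rfl fun l _ => this l, Finset.prod_const, Finset.card_univ,
    Fintype.card_fin]

/-- No neuron is activated by both `p` and `-p`, so the two covering events, of probability 1/4
each, are disjoint for each neuron. -/
theorem measureReal_uncovered_inter (hμ : ∀ ν, IsInitLaw r (μ ν)) {e : Fin k → ι}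
    (he : Function.Injective e) (p : Fin 2 → Bool) (t t' : Bool) :
    ((Measure.pi μ).prod (Measure.pi fun _ => uniformOn (Set.univ : Set Bool))).real
      (uncovered e p t ∩ uncovered e (opposite p) t') = (1 / 2) ^ k := by
  have := fun ν => (hμ ν).isProbabilityMeasure
  have hset : (uncovered e p t ∩ uncovered e (opposite p) t' :
      Set ((ι → Fin 2 → ℝ) × (ι → Bool))) =
      {ω | ∀ l, (ω.1 (e l), ω.2 (e l)) ∈ (activeWith p t ∪ activeWith (opposite p) t')ᶜ} := by
    ext ω
    simp only [uncovered, Set.mem_inter_iff, Set.mem_ofPred_eq, Set.compl_union, forall_and]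
  have hm := (measurableSet_activeWith p t).union (measurableSet_activeWith (opposite p) t')
  rw [hset, measureReal_forall_neuron μ _ he]
  have : ∀ l, ((μ (e l)).prod (uniformOn (Set.univ : Set Bool))).real
      (activeWith p t ∪ activeWith (opposite p) t')ᶜ = 1 / 2 := by
    intro l
    rw [probReal_compl_eq_one_sub hm, measureReal_union (disjoint_activeWith_opposite p t t')
      (measurableSet_activeWith _ _), measureReal_activeWith (hμ _), measureReal_activeWith (hμ _)]
    norm_num
  rw [Finset.prod_congr rfl fun l _ => this l, Finset.prod_const, Finset.card_univ,
    Fintype.card_fin]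

theorem eq_or_opposite (p : Fin 2 → Bool) :
    (p = ![true, true] ∨ p = opposite ![true, true]) ∨
      (p = ![true, false] ∨ p = opposite ![true, false]) := by
  have : ∀ q : Fin 2 → Bool, p = q ↔ p 0 = q 0 ∧ p 1 = q 1 := fun q => by
    rw [funext_iff, Fin.forall_fin_two]
  simp only [this, opposite]
  cases p 0 <;> cases p 1 <;> simp

/-- The probability that some pattern does not activate a neuron with the right output weight. -/
theorem measureReal_iUnion_uncovered_le (hμ : ∀ ν, IsInitLaw r (μ ν)) {e : Fin k → ι}
    (he : Function.Injective e) (target : (Fin 2 → Bool) → Bool) :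
    ((Measure.pi μ).prod (Measure.pi fun _ => uniformOn (Set.univ : Set Bool))).real
      (⋃ p, uncovered e p (target p)) ≤ 4 * (3 / 4) ^ k - 2 * (1 / 2) ^ k := by
  have := fun ν => (hμ ν).isProbabilityMeasure
  set Q := (Measure.pi μ).prod (Measure.pi fun _ : ι => uniformOn (Set.univ : Set Bool))
  -- Inclusion-exclusion within each opposite pair saves `2 (1/2)^k` over the plain union bound;
  -- `failure_bound` relies on this.
  have hpair : ∀ p, Q.real (uncovered e p (target p) ∪
      uncovered e (opposite p) (target (opposite p))) = 2 * (3 / 4) ^ k - (1 / 2) ^ k := by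
    intro p
    have h := measureReal_union_add_inter (μ := Q) (s := uncovered e p (target p))
      (measurableSet_uncovered e (opposite p) (target (opposite p)))
    rw [measureReal_uncovered_inter hμ he, measureReal_uncovered hμ he,
      measureReal_uncovered hμ he] at h
    linarith
  have hsub : (⋃ p, uncovered e p (target p)) ⊆
      (uncovered e ![true, true] (target ![true, true]) ∪
        uncovered e (opposite ![true, true]) (target (opposite ![true, true]))) ∪
      (uncovered e ![true, false] (target ![true, false]) ∪
        uncovered e (opposite ![true, false]) (target (opposite ![true, false]))) := by
    refine Set.iUnion_subset fun p => ?_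
    rcases eq_or_opposite p with (h | h) | (h | h) <;> rw [h]
    · exact fun _ hx => Or.inl (Or.inl hx)
    · exact fun _ hx => Or.inl (Or.inr hx)
    · exact fun _ hx => Or.inr (Or.inl hx)
    · exact fun _ hx => Or.inr (Or.inr hx)
  refine (measureReal_mono hsub).trans ((measureReal_union_le _ _).trans ?_)
  rw [hpair, hpair]
  linarith

end Cover

/-! ## Success of layerwise gradient descent -/

theorem trainedTo_depth {d m k : ℕ} {lam η : ℝ} {T : ℕ} {S : Fin m → Example d}
    {W₀ : Neuron d k → Fin 2 → ℝ} {V₀ : Neuron d k → Bool} :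
    trainedTo lam η T S W₀ V₀ (le_refl d) = id := by
  unfold trainedTo
  rw [Nat.decreasingInduction_self]

theorem trainedTo_succ {d m k : ℕ} {lam η : ℝ} {T : ℕ} {S : Fin m → Example d}
    {W₀ : Neuron d k → Fin 2 → ℝ} {V₀ : Neuron d k → Bool} {i : ℕ} (hi : i < d)
    (x : Fin (2 ^ d) → ℝ) :
    trainedTo lam η T S W₀ V₀ hi.le x =
      block (trainLayer lam η T S (trainedTo lam η T S W₀ V₀ (Nat.succ_le_of_lt hi))
          (fun j l => sgn (V₀ ⟨⟨i, hi⟩, j, l⟩)) (fun j l => W₀ ⟨⟨i, hi⟩, j, l⟩))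
        (fun j l => sgn (V₀ ⟨⟨i, hi⟩, j, l⟩))
        (trainedTo lam η T S W₀ V₀ (Nat.succ_le_of_lt hi) x) := by
  unfold trainedTo
  rw [Nat.decreasingInduction_succ_left (smn := hi)]

/-- The gates of the tree of depth `d`. -/
abbrev Gate (d : ℕ) : Type := (i : Fin d) × Fin (2 ^ (i : ℕ))

theorem card_gate (d : ℕ) : Fintype.card (Gate d) = 2 ^ d - 1 := by
  rw [Fintype.card_sigma]
  simp only [Fintype.card_fin]
  rw [Fin.sum_univ_eq_sum_range (fun i => 2 ^ i), Nat.geomSum_eq le_rfl]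
  simp

section Main

variable {d : ℕ} (C : TreeCircuit d) (D : Measure (Example d)) (lam : ℝ)

/-- The contribution of an example to the correlation of `y - λ` with a pattern at an ideal gate. -/
noncomputable def patternTerm (g : Gate d) (p : Fin 2 → Bool) (z : Example d) : ℝ :=
  if pattern (ideal C D (Nat.succ_le_of_lt g.1.2) z.1) g.2 = p then sgn z.2 - lam else 0

/-- The output that gradient descent aims at for a pattern at an ideal gate. -/
noncomputable def targetBit (g : Gate d) (p : Fin 2 → Bool) : Bool :=
  decide (0 < ∫ z, patternTerm C D lam g p z ∂D)

/-- The samples for which the empirical correlation of a pattern with its target is too small. -/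
def badSample (m : ℕ) (ε : ℝ) (g : Gate d) (p : Fin 2 → Bool) : Set (Fin m → Example d) :=
  {S | (1 / (m : ℝ)) * ∑ s, sgn (targetBit C D lam g p) * patternTerm C D lam g p (S s) ≤
    ∫ z, sgn (targetBit C D lam g p) * patternTerm C D lam g p z ∂D - ε}

variable {C D lam}

theorem measureReal_badSample_le [IsProbabilityMeasure D] (h0 : 0 ≤ lam) (h1 : lam ≤ 1) {m : ℕ}
    (hm : 0 < m) {ε : ℝ} (hε : 0 ≤ ε) (g : Gate d) (p : Fin 2 → Bool) :
    (Measure.pi fun _ : Fin m => D).real (badSample C D lam m ε g p) ≤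
      Real.exp (-(m * ε ^ 2 / 2)) := by
  have hf : ∀ z, sgn (targetBit C D lam g p) * patternTerm C D lam g p z ∈
      Set.Icc (-1 - sgn (targetBit C D lam g p) * lam)
        (-1 - sgn (targetBit C D lam g p) * lam + 2) := by
    intro z
    unfold patternTerm
    generalize targetBit C D lam g p = b
    generalize z.2 = y
    rw [Set.mem_Icc]
    cases b <;> cases y <;> simp only [sgn_true, sgn_false] <;> split_ifs <;>
      constructor <;> linarith
  exact measureReal_sampleMean_le D hm
    (f := fun z => sgn (targetBit C D lam g p) * patternTerm C D lam g p z) .of_discrete hf hε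

theorem patternTerm_mean (m : ℕ) (S : Fin m → Example d) (g : Gate d) (p : Fin 2 → Bool) :
    (1 / (m : ℝ)) * ∑ s, sgn (targetBit C D lam g p) * patternTerm C D lam g p (S s) =
      -(sgn (targetBit C D lam g p) *
        patternGrad lam S (ideal C D (Nat.succ_le_of_lt g.1.2)) g.2 p) := by
  unfold patternGrad
  rw [← Finset.mul_sum, mul_left_comm, ← mul_neg, ← mul_neg, ← Finset.sum_neg_distrib]
  congr 2
  refine Finset.sum_congr rfl fun s _ => ?_
  unfold patternTerm
  split_ifs <;> ring

theorem decide_eq_of_le_sgn_mul {a : ℝ} {b : Bool} {c : ℝ} (hc : 0 < c) (h : c ≤ sgn b * a) :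
    decide (0 < a) = b := by
  cases b
  · rw [sgn_false] at h
    rw [decide_eq_false_iff_not]
    linarith
  · rw [sgn_true] at h
    rw [decide_eq_true_iff]
    linarith

/-- The deterministic part. Because the layers below output exact signs on the entire cube, the
analysis of one gate applies again at the next level, always with the same ideal inputs. -/
theorem trainedTo_eq_ideal {m k T : ℕ} {η κ ε : ℝ} {S : Fin m → Example d}
    {W₀ : Neuron d k → Fin 2 → ℝ} {V₀ : Neuron d k → Bool}
    (h0 : 0 ≤ lam) (h1 : lam ≤ 1) (hk : 0 < k) (hη₀ : 0 < η) (hη : η ≤ 1 / (16 * √2 * k))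
    (htarget : ∀ (g : Gate d) x,
      targetBit C D lam g (pattern (ideal C D (Nat.succ_le_of_lt g.1.2) x) g.2) =
        ideal C D g.1.2.le x g.2)
    (hmargin : ∀ (g : Gate d) x, ε ≤ -(sgn (ideal C D g.1.2.le x g.2) *
      patternGrad lam S (ideal C D (Nat.succ_le_of_lt g.1.2)) g.2
        (pattern (ideal C D (Nat.succ_le_of_lt g.1.2) x) g.2)))
    (hW₀ : ∀ ν c, |W₀ ν c| ≤ 1 / (4 * √2 * k))
    (hcover : ∀ (g : Gate d) p, ∃ l, V₀ ⟨g.1, g.2, l⟩ = targetBit C D lam g p ∧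
      0 < W₀ ⟨g.1, g.2, l⟩ ⬝ᵥ signs p)
    (hκ : ∀ i < d, κ ≤ η / ((2 ^ i : ℕ) : ℝ) * ε) (hκ₀ : 0 < κ)
    (hT : 1 + 1 / (2 * √2) + 2 * κ < κ * T) {i : ℕ} (hi : i ≤ d) (x : Fin (2 ^ d) → Bool) :
    trainedTo lam η T S W₀ V₀ hi (fun a => sgn (x a)) = fun j => sgn (ideal C D hi x j) := by
  induction hi using Nat.decreasingInduction generalizing x with
  | self =>
    rw [trainedTo_depth, ideal_depth]
    rfl
  | of_succ i hi ih =>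
    rw [trainedTo_succ hi]
    funext j
    have h := neuralGate_trainLayer (lam := lam) (S := S) (η := η) (κ := κ) (T := T)
      (N := trainedTo lam η T S W₀ V₀ (Nat.succ_le_of_lt hi))
      (u := ideal C D (Nat.succ_le_of_lt hi)) ih h0 h1 hk hη₀ hη
      (fun j l => sgn (V₀ ⟨⟨i, hi⟩, j, l⟩)) (fun j l => W₀ ⟨⟨i, hi⟩, j, l⟩) j
      (fun l => by cases V₀ ⟨⟨i, hi⟩, j, l⟩ <;> simp [sgn]) (fun l c => hW₀ _ c)
      (targetBit C D lam ⟨⟨i, hi⟩, j⟩) hκ₀ (fun x' => ?_) (fun p => ?_) hT x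
    · rw [htarget ⟨⟨i, hi⟩, j⟩ x] at h
      rw [ih]
      exact h
    · rw [htarget ⟨⟨i, hi⟩, j⟩ x', ← mul_neg]
      exact (hκ i hi).trans (mul_le_mul_of_nonneg_left (hmargin ⟨⟨i, hi⟩, j⟩ x') (by positivity))
    · obtain ⟨l, hl, hpos⟩ := hcover ⟨⟨i, hi⟩, j⟩ p
      exact ⟨l, by rw [hl], hpos⟩

end Main

/-! ## Numerical estimates -/

/-- Since `n ≥ 2 · 2^i`, the right side exceeds `9√2/8 > 1.58`, while the left side is at most `1 +
√2/4 + 1/50 < 1.38`. -/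
theorem step_count_bound {n i : ℕ} {Δ η κ : ℝ} {k T : ℕ} (hk : 0 < k)
    (hΔ : Δ ∈ Set.Ioo (0 : ℝ) (1 / 2)) (hη₀ : 0 < η) (hη : η ≤ 1 / (16 * √2 * k))
    (hn : 2 * 2 ^ i ≤ n) (hκ : κ = η / ((2 ^ i : ℕ) : ℝ) * (3 * Δ ^ 3 / 64))
    (hT : 24 * n / (√2 * η * Δ ^ 3) < T) : 1 + 1 / (2 * √2) + 2 * κ < κ * T := by
  have hΔ0 := hΔ.1
  have h2i : (1 : ℝ) ≤ ((2 ^ i : ℕ) : ℝ) := by exact_mod_cast Nat.one_le_two_pow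
  have hk' : (1 : ℝ) ≤ k := by exact_mod_cast hk
  have hs1 : (1.41 : ℝ) < √2 := by
    rw [Real.lt_sqrt] <;> norm_num
  have hs2 : √2 < (1.42 : ℝ) := by
    rw [Real.sqrt_lt'] <;> norm_num
  have hs : √2 * √2 = 2 := Real.mul_self_sqrt (by norm_num)
  have hκ0 : 0 < κ := by
    rw [hκ]
    positivity
  have hκT : κ * (24 * n / (√2 * η * Δ ^ 3)) < κ * T := mul_lt_mul_of_pos_left hT hκ0
  have hval : κ * (24 * n / (√2 * η * Δ ^ 3)) = n / ((2 ^ i : ℕ) : ℝ) * (9 / 8) * (1 / √2) := by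
    rw [hκ]
    field_simp
    ring
  have hq : (2 : ℝ) ≤ n / ((2 ^ i : ℕ) : ℝ) := by
    rw [le_div_iff₀ (by linarith)]
    exact_mod_cast hn
  have hinv : 1 / √2 = √2 / 2 := by
    field_simp
    linarith
  have hη1 : η ≤ 1 / 16 := by
    refine hη.trans ?_
    rw [div_le_div_iff₀ (by positivity) (by norm_num)]
    nlinarith
  have hΔ3 : Δ ^ 3 ≤ (1 / 2) ^ 3 := pow_le_pow_left₀ hΔ0.le hΔ.2.le 3
  have hκ1 : κ ≤ 1 / 100 := by
    have h1 : η / ((2 ^ i : ℕ) : ℝ) ≤ 1 / 16 := (div_le_self hη₀.le h2i).trans hη1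
    have h2 : 3 * Δ ^ 3 / 64 ≤ 1 / 64 := by linarith
    rw [hκ]
    exact (mul_le_mul h1 h2 (by positivity) (by norm_num)).trans (by norm_num)
  have h4 : 1 / (2 * √2) = √2 / 4 := by
    rw [← div_div, div_right_comm, hinv]
    ring
  rw [h4]
  rw [hval, hinv] at hκT
  nlinarith

/-- The exponent is `mΔ⁶/2¹³`, which the sample size makes larger than four times the logarithm. -/
theorem sample_size_bound {n d : ℕ} {Δ δ : ℝ} {m : ℕ} (hn : 2 ≤ n) (hd : 1 ≤ d)
    (hδ : δ ∈ Set.Ioo (0 : ℝ) (1 / 2)) (hΔ : Δ ∈ Set.Ioo (0 : ℝ) (1 / 2))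
    (hm : 2 ^ 15 / Δ ^ 6 * Real.log (8 * n * d / δ) < m) :
    0 < m ∧ Real.exp (-(m * (Δ ^ 3 / 64) ^ 2 / 2)) ≤ (δ / (8 * n * d)) ^ 4 := by
  have hδ0 := hδ.1
  have hΔ0 := hΔ.1
  have hn' : (2 : ℝ) ≤ n := by exact_mod_cast hn
  have hd' : (1 : ℝ) ≤ d := by exact_mod_cast hd
  have hx : 1 < 8 * n * d / δ := by
    rw [one_lt_div hδ0]
    nlinarith [hδ.2]
  have hL := Real.log_pos hx
  constructor
  · have : (0 : ℝ) < m := lt_trans (by positivity) hm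
    exact_mod_cast this
  · have h1 : δ / (8 * n * d) = Real.exp (-Real.log (8 * n * d / δ)) := by
      rw [Real.exp_neg, Real.exp_log (by linarith), inv_div]
    rw [h1, ← Real.exp_nat_mul, Real.exp_le_exp]
    rw [div_mul_eq_mul_div, div_lt_iff₀ (by positivity)] at hm
    push_cast
    nlinarith

theorem width_bound {n d : ℕ} {δ : ℝ} {k : ℕ} (hn : 2 ≤ n) (hd : 1 ≤ d)
    (hδ : δ ∈ Set.Ioo (0 : ℝ) (1 / 2)) (hk : (Real.log (4 / 3))⁻¹ * Real.log (2 * n * d / δ) ≤ k) :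
    0 < k ∧ (3 / 4 : ℝ) ^ k ≤ δ / (2 * n * d) := by
  have hδ0 := hδ.1
  have hn' : (2 : ℝ) ≤ n := by exact_mod_cast hn
  have hd' : (1 : ℝ) ≤ d := by exact_mod_cast hd
  have hx : 1 < 2 * n * d / δ := by
    rw [one_lt_div hδ0]
    nlinarith [hδ.2]
  have hL := Real.log_pos hx
  have hl : 0 < Real.log (4 / 3) := Real.log_pos (by norm_num)
  constructor
  · have : (0 : ℝ) < k := lt_of_lt_of_le (by positivity) hk
    exact_mod_cast this
  · have h1 : δ / (2 * n * d) = Real.exp (-Real.log (2 * n * d / δ)) := by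
      rw [Real.exp_neg, Real.exp_log (by linarith), inv_div]
    have h2 : (3 / 4 : ℝ) = Real.exp (-Real.log (4 / 3)) := by
      rw [Real.exp_neg, Real.exp_log (by norm_num), inv_div]
    rw [h1, h2, ← Real.exp_nat_mul, Real.exp_le_exp]
    rw [inv_mul_le_iff₀ hl] at hk
    linarith

/-- For `d = 1` the four terms `(3/4)^k` may already use up all of `δ`, so the failure of the sample
must be paid by `-2 (1/2)^k`. With `r = (3/4)^k ≤ x = δ/(2nd)` one has `(1/2)^k ≥ r³`, because
`(3/4)³ ≤ 1/2`; then `4r - 2r³ ≤ 4x - 2x³`, and `2x³` absorbs the sampling term. -/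
theorem failure_bound {n d : ℕ} {δ : ℝ} {k : ℕ} (hn : 2 ≤ n) (hd : 1 ≤ d) (hnd : 2 * (n - 1) ≤ n * d)
    (hδ : δ ∈ Set.Ioo (0 : ℝ) (1 / 2)) (hk : (3 / 4 : ℝ) ^ k ≤ δ / (2 * n * d)) :
    ((n - 1 : ℕ) : ℝ) * (4 * (δ / (8 * n * d)) ^ 4 + (4 * (3 / 4) ^ k - 2 * (1 / 2) ^ k)) ≤ δ := by
  have hδ0 := hδ.1
  have hn' : (2 : ℝ) ≤ n := by exact_mod_cast hn
  have hd' : (1 : ℝ) ≤ d := by exact_mod_cast hd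
  have hy : δ / (8 * n * d) = δ / (2 * n * d) / 4 := by
    field_simp
    norm_num
  have hhalf : ((3 / 4 : ℝ) ^ k) ^ 3 ≤ (1 / 2) ^ k := by
    rw [← pow_mul, mul_comm, pow_mul]
    exact pow_le_pow_left₀ (by norm_num) (by norm_num) k
  have hr0 : (0 : ℝ) ≤ (3 / 4) ^ k := by positivity
  have hx1 : δ / (2 * n * d) ≤ 1 / 8 := by
    rw [div_le_div_iff₀ (by positivity) (by norm_num)]
    nlinarith [hδ.2]
  have hx4 : ((n - 1 : ℕ) : ℝ) * (4 * (δ / (2 * n * d))) ≤ δ := by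
    have h1 : 2 * ((n - 1 : ℕ) : ℝ) ≤ n * d := by exact_mod_cast hnd
    have h2 : ((n - 1 : ℕ) : ℝ) * (4 * (δ / (2 * n * d))) =
        2 * ((n - 1 : ℕ) : ℝ) * δ / (n * d) := by
      field_simp
      norm_num
    rw [h2, div_le_iff₀ (by positivity), mul_comm δ]
    exact mul_le_mul_of_nonneg_right h1 hδ0.le
  rw [hy]
  have hx0 : 0 < δ / (2 * n * d) := by positivity
  generalize δ / (2 * n * d) = x at *
  generalize (3 / 4 : ℝ) ^ k = r at *
  refine le_trans (mul_le_mul_of_nonneg_left ?_ (Nat.cast_nonneg _)) hx4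
  have h1 : x ^ 3 - r ^ 3 ≤ x - r := by
    have : x ^ 3 - r ^ 3 = (x - r) * (x ^ 2 + x * r + r ^ 2) := by ring
    rw [this]
    have : x ^ 2 + x * r + r ^ 2 ≤ 1 := by nlinarith
    nlinarith
  have h2 : 4 * (x / 4) ^ 4 ≤ 2 * x ^ 3 := by
    have : 4 * (x / 4) ^ 4 = x ^ 3 * (x / 64) := by ring
    rw [this]
    have := pow_pos hx0 3
    nlinarith
  linarith

/-! ### The main theorem: union bound and conclusion -/

theorem mainTheorem2 (d : ℕ) (hd : 1 ≤ d) (n : ℕ) (hn : n = 2 ^ d)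
    (δ Δ : ℝ) (hδ : δ ∈ Set.Ioo (0 : ℝ) (1 / 2)) (hΔ : Δ ∈ Set.Ioo (0 : ℝ) (1 / 2))
    (k : ℕ) (hk : (Real.log (4 / 3))⁻¹ * Real.log (2 * n * d / δ) ≤ k)
    (η : ℝ) (hη₀ : 0 < η) (hη : η ≤ 1 / (16 * √2 * k))
    (C : TreeCircuit d) (hC : ∃ x x', C.eval x ≠ C.eval x')
    (D : Measure (Example d)) [IsProbabilityMeasure D]
    (hprod : NondegenerateProduct D Δ) (hsep : SeparableBy C D)
    (hmean : 0 ≤ labelMean D) (hlca : LCA C D Δ)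
    (lam : ℝ) (hlam : lam = labelMean D + Δ / 4)
    (μ : Neuron d k → Measure (Fin 2 → ℝ)) (hμ : ∀ ν, IsInitLaw (1 / (4 * √2 * k)) (μ ν))
    (m : ℕ) (hm : 2 ^ 15 / Δ ^ 6 * Real.log (8 * n * d / δ) < m)
    (T : ℕ) (hT : 24 * n / (√2 * η * Δ ^ 3) < T) :
    ENNReal.ofReal (1 - δ) ≤ runLaw m D μ
      {ω | D {z | trainedNet lam η T ω.1 ω.2.1 ω.2.2 z.1 ≠ sgn z.2} = 0} := by
  have hn2 : 2 ≤ n := by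
    rw [hn]
    exact (Nat.pow_le_pow_right (by norm_num) hd).trans' (by norm_num)
  have hΔ0 := hΔ.1
  have hΔ1 := hΔ.2
  have hlt := labelMean_add_lt_one hd hC hlca
  have h0 : 0 ≤ lam := by linarith
  have h1 : lam ≤ 1 := by linarith
  obtain ⟨hm0, hexp⟩ := sample_size_bound hn2 hd hδ hΔ hm
  obtain ⟨hk0, hpow⟩ := width_bound hn2 hd hδ hk
  have := fun ν => (hμ ν).isProbabilityMeasure
  -- A quarter of the population margin `Δ³/16` is given up to sampling; `3Δ³/64` remains.
  set ε := Δ ^ 3 / 64 with hε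
  have hε0 : 0 < ε := by positivity
  set PS := Measure.pi fun _ : Fin m => D
  set PI := (Measure.pi μ).prod (Measure.pi fun _ : Neuron d k => uniformOn (Set.univ : Set Bool))
  have hlaw : runLaw m D μ = PS.prod PI := rfl
  let neuron : Gate d → Fin k → Neuron d k := fun g l => ⟨g.1, g.2, l⟩
  have hneuron : ∀ g, Function.Injective (neuron g) := by
    intro g l l' h
    simpa [neuron] using h
  let unbounded : Set ((Neuron d k → Fin 2 → ℝ) × (Neuron d k → Bool)) :=
    {ω | ¬∀ ν c, |ω.1 ν c| ≤ 1 / (4 * √2 * k)}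
  have hunb : PI.real unbounded = 0 := by
    have h : ∀ᵐ W ∂(Measure.pi μ), ∀ ν c, |W ν c| ≤ 1 / (4 * √2 * k) := by
      rw [ae_all_iff]
      intro ν
      exact (Measure.quasiMeasurePreserving_eval μ ν).ae (hμ ν).bounded
    have h' : ∀ᵐ ω ∂PI, ∀ ν c, |ω.1 ν c| ≤ 1 / (4 * √2 * k) :=
      Measure.quasiMeasurePreserving_fst.ae h
    rw [measureReal_def, show PI unbounded = 0 from h', ENNReal.toReal_zero]
  let bad : Gate d → Set ((Fin m → Example d) × (Neuron d k → Fin 2 → ℝ) × (Neuron d k → Bool)) :=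
    fun g => (⋃ p, badSample C D lam m ε g p) ×ˢ Set.univ ∪
      Set.univ ×ˢ ⋃ p, uncovered (neuron g) p (targetBit C D lam g p)
  have hbad : ∀ g, (PS.prod PI).real (bad g) ≤
      4 * (δ / (8 * n * d)) ^ 4 + (4 * (3 / 4) ^ k - 2 * (1 / 2) ^ k) := by
    intro g
    refine (measureReal_union_le _ _).trans (add_le_add ?_ ?_)
    · rw [measureReal_prod_prod, probReal_univ, mul_one]
      refine (measureReal_iUnion_fintype_le _).trans ?_
      refine (Finset.sum_le_sum fun p _ =>
        (measureReal_badSample_le h0 h1 hm0 hε0.le g p).trans hexp).trans (le_of_eq ?_)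
      simp
    · rw [measureReal_prod_prod, probReal_univ, one_mul]
      exact measureReal_iUnion_uncovered_le hμ (hneuron g) _
  have hall : (PS.prod PI).real ((⋃ g, bad g) ∪ Set.univ ×ˢ unbounded) ≤ δ := by
    refine (measureReal_union_le _ _).trans ?_
    rw [measureReal_prod_prod, hunb, mul_zero, add_zero]
    refine (measureReal_iUnion_fintype_le _).trans ((Finset.sum_le_sum fun g _ => hbad g).trans ?_)
    rw [Finset.sum_const, nsmul_eq_mul, Finset.card_univ, card_gate, ← hn]
    refine failure_bound hn2 hd ?_ hδ hpow
    rcases hd.eq_or_lt with rfl | hd2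
    · omega
    · have := Nat.mul_le_mul_left n (Nat.succ_le_of_lt hd2)
      omega
  have hsub : {ω : (Fin m → Example d) × (Neuron d k → Fin 2 → ℝ) × (Neuron d k → Bool) |
      D {z | trainedNet lam η T ω.1 ω.2.1 ω.2.2 z.1 ≠ sgn z.2} = 0}ᶜ ⊆
        (⋃ g, bad g) ∪ Set.univ ×ˢ unbounded := by
    rw [Set.compl_subset_comm]
    rintro ⟨S, W₀, V₀⟩ hω
    rw [Set.compl_union, Set.mem_inter_iff, Set.mem_compl_iff, Set.mem_compl_iff,
      Set.mem_iUnion, not_exists] at hω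
    obtain ⟨hω1, hω2⟩ := hω
    have hW : ∀ ν c, |W₀ ν c| ≤ 1 / (4 * √2 * k) := by
      by_contra hcon
      exact hω2 ⟨Set.mem_univ _, hcon⟩
    have hmain : ∀ (g : Gate d) x,
        targetBit C D lam g (pattern (ideal C D (Nat.succ_le_of_lt g.1.2) x) g.2) =
          ideal C D g.1.2.le x g.2 ∧
        3 * Δ ^ 3 / 64 ≤ -(sgn (ideal C D g.1.2.le x g.2) *
          patternGrad lam S (ideal C D (Nat.succ_le_of_lt g.1.2)) g.2
            (pattern (ideal C D (Nat.succ_le_of_lt g.1.2) x) g.2)) := by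
      intro g x
      have hpm := pattern_margin hd hΔ0 hΔ1 hprod hC hsep hmean hlca g.1.2 g.2 x
      rw [← hlam] at hpm
      have ht' : targetBit C D lam g (pattern (ideal C D (Nat.succ_le_of_lt g.1.2) x) g.2) =
          ideal C D g.1.2.le x g.2 :=
        decide_eq_of_le_sgn_mul (by positivity) hpm
      refine ⟨ht', ?_⟩
      by_contra hcon
      refine hω1 g (Or.inl ⟨Set.mem_iUnion.2
        ⟨pattern (ideal C D (Nat.succ_le_of_lt g.1.2) x) g.2, ?_⟩, Set.mem_univ _⟩)
      unfold badSample
      rw [Set.mem_ofPred_eq, patternTerm_mean, ht', integral_const_mul]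
      refine (not_le.1 hcon).le.trans ?_
      have : 3 * Δ ^ 3 / 64 = Δ ^ 3 / 16 - ε := by rw [hε]; ring
      rw [this]
      exact sub_le_sub_right hpm _
    have hcover : ∀ (g : Gate d) p, ∃ l, V₀ ⟨g.1, g.2, l⟩ = targetBit C D lam g p ∧
        0 < W₀ ⟨g.1, g.2, l⟩ ⬝ᵥ signs p := by
      intro g p
      by_contra! hcon
      refine hω1 g (Or.inr ⟨Set.mem_univ _, Set.mem_iUnion.2 ⟨p, fun l hl => ?_⟩⟩)
      exact (hcon l hl.2).not_gt hl.1
    -- Level `d - 1` has the most gates, so pooling makes its steps smallest; its `κ` serves all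
    -- levels.
    have hfinal := fun x => trainedTo_eq_ideal (κ := η / ((2 ^ (d - 1) : ℕ) : ℝ) * (3 * Δ ^ 3 / 64))
      (T := T) h0 h1 hk0 hη₀ hη (fun g x => (hmain g x).1)
      (fun g x => (hmain g x).2) hW hcover
      (fun i hi => by
        gcongr
        · norm_num
        · omega)
      (by positivity) (step_count_bound (i := d - 1) hk0 hΔ hη₀ hη
        (by rw [hn, ← pow_succ', Nat.sub_add_cancel hd]) rfl hT) (Nat.zero_le d) x
    rw [Set.mem_ofPred_eq]
    refine measure_mono_null ?_ (ae_iff.1 hsep)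
    intro z hz heq
    apply hz
    unfold trainedNet
    rw [hfinal]
    dsimp only
    rw [ideal_root hd hsep, heq]
  rw [hlaw]
  set s := {ω : (Fin m → Example d) × (Neuron d k → Fin 2 → ℝ) × (Neuron d k → Bool) |
      D {z | trainedNet lam η T ω.1 ω.2.1 ω.2.2 z.1 ≠ sgn z.2} = 0}
  have hc : (PS.prod PI) sᶜ ≤ ENNReal.ofReal δ := by
    refine (measure_mono hsub).trans ?_
    rw [← ofReal_measureReal]
    exact ENNReal.ofReal_le_ofReal hall
  rw [ENNReal.ofReal_sub _ hδ.1.le, ENNReal.ofReal_one, tsub_le_iff_right]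
  -- Subadditivity suffices here, so the success event need not be shown measurable.
  calc (1 : ENNReal) = (PS.prod PI) Set.univ := measure_univ.symm
    _ = (PS.prod PI) (s ∪ sᶜ) := by rw [Set.union_compl_self]
    _ ≤ (PS.prod PI) s + (PS.prod PI) sᶜ := measure_union_le _ _
    _ ≤ (PS.prod PI) s + ENNReal.ofReal δ := by gcongr
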